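/- For $a,b,c>0$ let $$\Phi(x)={}_1F_2\left(a;b,c;-\frac{x^2}{4}\right)=\sum_{k=0}^\infty\frac{(a)_k}{k!\,(b)_k\,(c)_k}\left(-\frac{x^2}{4}\right)^k\qquad(x>0),$$ where $(\alpha)_k=\Gamma(\alpha+k)/\Gamma(\alpha)$. For $\alpha>-1$ let $j_\alpha$ denote the smallest positive zero of the Bessel function $J_\alpha$. Say that $\Phi$ alternates in sign if it takes both positive and negative values on $(0,\infty)$. Let $\mathcal P_{1,2}$ be the set of all $(a,b,c)$ with $a,b,c>0$ such that $\Phi(x)>0$ for all $x>0$. If $(a,b,c)\in\mathcal P_{1,2}$, then necessarily $b>a$, $c>a$ and $b+c\ge 3a+\frac12$. Moreover: (i) If $0<b\le a$, then $\Phi$ alternates in sign and has at least one zero in $(0,j_{c-1}]$. If $0<c\le a$, then $\Phi$ alternates in sign and has at least one zero in $(0,j_{b-1}]$. (ii) Suppose that either $b\le a+\frac12$ and $c\le 2a$, or $b\le 2a$ and $c\le a+\frac12$; suppose also that $b+c<3a+\frac12$. Then $\Phi$ alternates in sign and has at least one zero in $(0,2j_{a-\frac12})$. -/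

import Mathlib

open Set
open scoped Nat

noncomputable section

/-- The `k`-th coefficient `(a)_k / (k! (b)_k (c)_k)` of the series of `₁F₂(a; b, c; ·)`, where
`(α)_k = α (α + 1) ⋯ (α + k - 1)` is the Pochhammer symbol. -/
def hyp12Coeff (a b c : ℝ) (k : ℕ) : ℝ :=
  (ascPochhammer ℝ k).eval a /
    ((k ! : ℝ) * (ascPochhammer ℝ k).eval b * (ascPochhammer ℝ k).eval c)

/-- The generalized hypergeometric function
`₁F₂(a; b, c; z) = ∑ₖ (a)_k / (k! (b)_k (c)_k) z ^ k`, for real parameters and argument. -/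
def hyp12 (a b c z : ℝ) : ℝ := ∑' k : ℕ, hyp12Coeff a b c k * z ^ k

/-- For positive `b` and `c`, the real `hyp12` is Mathlib's regularized hypergeometric function
with the regularizing factor `Γ(b) Γ(c)` restored; the series converges. -/
theorem hasSum_hyp12 {a b c : ℝ} (hb : 0 < b) (hc : 0 < c) (z : ℝ) :
    HasSum (fun k : ℕ => hyp12Coeff a b c k * z ^ k) (hyp12 a b c z) ∧
      (hyp12 a b c z : ℂ) =
        Complex.Gamma b * Complex.Gamma c *
          Complex.regularizedHGFun {(a : ℂ)} {(b : ℂ), (c : ℂ)} z := by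
  have hrad : (Complex.regularizedHGFunSeries {(a : ℂ)} {(b : ℂ), (c : ℂ)}).radius = ⊤ :=
    Complex.radius_regularizedHGFunSeries_eq_top (by simp)
  have hmem : (z : ℂ) ∈ Metric.eball (0 : ℂ)
      (Complex.regularizedHGFunSeries {(a : ℂ)} {(b : ℂ), (c : ℂ)}).radius := by
    rw [hrad]; simp
  have h1 := (Complex.regularizedHGFunSeries {(a : ℂ)} {(b : ℂ), (c : ℂ)}).hasSum hmem
  have h2 := h1.mul_left (Complex.Gamma b * Complex.Gamma c)
  have hcoe : ∀ (x : ℝ) (k : ℕ),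
      (((ascPochhammer ℝ k).eval x : ℝ) : ℂ) = (ascPochhammer ℂ k).eval (x : ℂ) := by
    intro x k
    have h := Polynomial.eval_map_apply (f := Complex.ofRealHom) (p := ascPochhammer ℝ k) x
    rw [ascPochhammer_map] at h
    simpa using h.symm
  have hG : ∀ x : ℝ, 0 < x → Complex.Gamma x ≠ 0 := by
    intro x hx
    exact Complex.Gamma_ne_zero_of_re_pos (by simpa using hx)
  have hnn : ∀ x : ℝ, 0 < x → ∀ n : ℕ, (x : ℂ) ≠ -(n : ℂ) := by
    intro x hx n h
    have := congrArg Complex.re h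
    simp at this
    have hn : (0 : ℝ) ≤ n := n.cast_nonneg
    linarith
  have h3 : HasSum (fun k : ℕ => ((hyp12Coeff a b c k * z ^ k : ℝ) : ℂ))
      (Complex.Gamma b * Complex.Gamma c *
        Complex.regularizedHGFun {(a : ℂ)} {(b : ℂ), (c : ℂ)} z) := by
    refine h2.congr_fun ?_
    intro k
    have e1 := Complex.Gamma_add_nat_div_Gamma_eq (b : ℂ) (hnn b hb) (n := k)
    have e2 := Complex.Gamma_add_nat_div_Gamma_eq (c : ℂ) (hnn c hc) (n := k)
    rw [Complex.regularizedHGFunSeries, FormalMultilinearSeries.ofScalars_apply_eq,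
      Complex.regularizedHGFunCoeff]
    have g1 := hG b hb
    have g2 := hG c hc
    rw [div_eq_iff g1] at e1
    rw [div_eq_iff g2] at e2
    simp only [hyp12Coeff, Complex.ofReal_mul, Complex.ofReal_div, Complex.ofReal_pow, hcoe,
      Complex.ofReal_natCast, Multiset.map_singleton, Multiset.prod_singleton,
      Multiset.insert_eq_cons, Multiset.map_cons, Multiset.prod_cons, smul_eq_mul, e1, e2]
    field_simp
  have h4 : Summable (fun k : ℕ => hyp12Coeff a b c k * z ^ k) :=
    Complex.summable_ofReal.mp h3.summable
  exact ⟨h4.hasSum, (Complex.hasSum_ofReal.mpr h4.hasSum).unique h3⟩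

/-- The set of all triples `(a, b, c)` of positive reals such that
`₁F₂(a; b, c; -x²/4)` is strictly positive for all `x > 0`. -/
def positivitySet : Set (ℝ × ℝ × ℝ) :=
  {p | 0 < p.1 ∧ 0 < p.2.1 ∧ 0 < p.2.2 ∧
    ∀ x : ℝ, 0 < x → 0 < hyp12 p.1 p.2.1 p.2.2 (-(x ^ 2 / 4))}

/-- The Bessel function of the first kind of real order `α` at `x > 0`,
`J_α(x) = ∑ₖ (-1)^k / (k! Γ(k + α + 1)) (x / 2)^(2 k + α)`. -/
def besselJ (α x : ℝ) : ℝ :=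
  ∑' k : ℕ, (-1 : ℝ) ^ k / ((k ! : ℝ) * Real.Gamma (k + α + 1)) * (x / 2) ^ (2 * (k : ℝ) + α)

/-- `j_α`, the smallest positive zero of `J_α` (used for `α > -1`). The positive zeros of `J_α`
form a nonempty set which is closed in `ℝ`, so the infimum is attained. -/
def besselZero (α : ℝ) : ℝ := sInf {x : ℝ | 0 < x ∧ besselJ α x = 0}

/-- `f` alternates in sign on `(0, ∞)`: it takes negative as well as positive values there. -/
def AlternatesInSign (f : ℝ → ℝ) : Prop :=
  (∃ x : ℝ, 0 < x ∧ f x < 0) ∧ ∃ y : ℝ, 0 < y ∧ 0 < f y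

end

namespace Hyp12

open MeasureTheory ProbabilityTheory Filter Topology

/-! ### Pochhammer symbols -/

/-! Two mechanisms carry the theorem.

Sign changes (parts (i), (ii), and b > a, c > a): raising a denominator parameter from b to b + q
averages `t ↦ hyp12 a b c (t * z)` against the Beta(b, q) law (`hyp12_add_eq_integral`). Hence
nonnegativity on an initial interval becomes strict positivity, up to and including its endpoint
(`hyp12_pos_of_nonneg`). Raising b to a gives ₀F₁(; c; ·), a Bessel function J_{c-1} up to a power,
which vanishes at j_{c-1}. Raising (b, c) to (a + 1/2, 2a) gives the square of a Bessel function
(`hyp12_eq_sq`), which vanishes at 2 j_{a-1/2}. So the original function is negative somewhere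
before that point, and the intermediate value theorem supplies a zero.

The inequality b + c ≥ 3a + 1/2: put m = b + 1/2. The Laplace transform of x^(2b-1) Φ(x) is L(p) =
Γ(2b) p ∫ (p² + t)^(-m) dBeta(a, c - a)(t). If Φ ≥ 0 then |L(p)| ≤ L(Re p). At p = ε the mass near t
= 0 dominates and L(ε) is about ε^(1-2m+2a). At suitable p = ε + iy with y near 1 the mass near t =
1 dominates and |L(p)| is at least of order ε^(c-a-m). Letting ε → 0 forces c - a - m ≥ 1 - 2m + 2a,
which is the claim. The singularity at p = ±i thus may not exceed the one at 0. -/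

lemma poch_pos {a : ℝ} (ha : 0 < a) (k : ℕ) : 0 < (ascPochhammer ℝ k).eval a :=
  ascPochhammer_pos k a ha

lemma gamma_add_nat {b : ℝ} (hb : 0 < b) (k : ℕ) :
    Real.Gamma (b + k) = (ascPochhammer ℝ k).eval b * Real.Gamma b := by
  induction k with
  | zero => simp
  | succ k ih =>
    have h : b + (k : ℝ) ≠ 0 := by positivity
    rw [ascPochhammer_succ_eval, Nat.cast_succ, ← add_assoc, Real.Gamma_add_one h, ih]
    ring

lemma poch_add (x : ℝ) (i j : ℕ) : (ascPochhammer ℝ (i + j)).eval x =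
    (ascPochhammer ℝ i).eval x * (ascPochhammer ℝ j).eval (x + i) := by
  rw [← ascPochhammer_mul, Polynomial.eval_mul, Polynomial.eval_comp]
  simp

lemma choose_mul_factorial (r : ℝ) (n : ℕ) :
    Ring.choose r n * n ! = (ascPochhammer ℝ n).eval (r - n + 1) := by
  have h := Ring.factorial_nsmul_multichoose_eq_ascPochhammer (r - n + 1) n
  rw [nsmul_eq_mul, ← Polynomial.eval₂_smulOneHom_eq_smeval, ← Polynomial.eval_map] at h
  rw [mul_comm, Ring.choose, h]
  congr 1
  rw [Subsingleton.elim (RingHom.smulOneHom : ℕ →+* ℝ) (algebraMap ℕ ℝ), ascPochhammer_map]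

/-- The duplication formula for Pochhammer symbols. -/
lemma poch_two_mul (a : ℝ) (n : ℕ) : (ascPochhammer ℝ (2 * n)).eval (2 * a) =
    4 ^ n * (ascPochhammer ℝ n).eval a * (ascPochhammer ℝ n).eval (a + 1 / 2) := by
  induction n with
  | zero => simp
  | succ n ih =>
    rw [show 2 * (n + 1) = 2 * n + 1 + 1 by ring, ascPochhammer_succ_eval, ascPochhammer_succ_eval,
      ih, ascPochhammer_succ_eval, ascPochhammer_succ_eval]
    push_cast
    ring

/-- The Chu–Vandermonde identity, in the form giving the coefficients of `₀F₁(; d; ·)²`. -/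
lemma sum_antidiagonal_inv_poch {d : ℝ} (hd : 0 < d) (n : ℕ) :
    ∑ ij ∈ Finset.HasAntidiagonal.antidiagonal n, 1 / ((ij.1 ! : ℝ) * (ascPochhammer ℝ ij.1).eval d) *
      (1 / ((ij.2 ! : ℝ) * (ascPochhammer ℝ ij.2).eval d)) =
    (ascPochhammer ℝ n).eval (2 * d + n - 1) /
      ((n ! : ℝ) * (ascPochhammer ℝ n).eval d * (ascPochhammer ℝ n).eval d) := by
  -- Since (d)_n = (d)_j (d + j)_i, each mixed factor is a binomial coefficient over (d)_n. Pairing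
  -- i! with (d)_j and j! with (d)_i turns the sum into Vandermonde's convolution.
  have key : ∀ i j : ℕ, i + j = n → 1 / ((i ! : ℝ) * (ascPochhammer ℝ j).eval d) =
      Ring.choose (d + n - 1) i / (ascPochhammer ℝ n).eval d := by
    intro i j hij
    have h1 := choose_mul_factorial (d + n - 1) i
    have h2 := poch_add d j i
    rw [add_comm j i, hij] at h2
    rw [show d + (n : ℝ) - 1 - i + 1 = d + j by rw [← hij]; push_cast; ring] at h1
    have hn := (poch_pos hd n).ne'
    have hj := (poch_pos hd j).ne'
    have hi : (i ! : ℝ) ≠ 0 := by positivity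
    rw [div_eq_div_iff (by positivity) hn, h2, ← h1]
    ring
  have hn := (poch_pos hd n).ne'
  have hf : (n ! : ℝ) ≠ 0 := by positivity
  have h3 := choose_mul_factorial ((d + n - 1) + (d + n - 1)) n
  rw [Ring.add_choose_eq n (Commute.all _ _),
    show d + (n : ℝ) - 1 + (d + n - 1) - n + 1 = 2 * d + n - 1 by ring] at h3
  rw [← h3]
  trans ∑ ij ∈ Finset.HasAntidiagonal.antidiagonal n, Ring.choose (d + n - 1) ij.1 * Ring.choose (d + n - 1) ij.2 /
      ((ascPochhammer ℝ n).eval d * (ascPochhammer ℝ n).eval d)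
  · refine Finset.sum_congr rfl fun ij hij => ?_
    rw [Finset.HasAntidiagonal.mem_antidiagonal] at hij
    have e1 := key ij.1 ij.2 hij
    have e2 := key ij.2 ij.1 (by rw [add_comm]; exact hij)
    rw [mul_div_mul_comm, ← e1, ← e2]
    field_simp
  · rw [← Finset.sum_div]
    field_simp

/-! ### The series of `₁F₂` -/

lemma coeff_pos {a b c : ℝ} (ha : 0 < a) (hb : 0 < b) (hc : 0 < c) (k : ℕ) :
    0 < hyp12Coeff a b c k := by
  have := poch_pos ha k
  have := poch_pos hb k
  have := poch_pos hc k
  unfold hyp12Coeff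
  positivity

lemma hyp12_symm (a b c z : ℝ) : hyp12 a b c z = hyp12 a c b z := by
  unfold hyp12 hyp12Coeff
  simp only [mul_right_comm]

lemma hasSum {a b c : ℝ} (hb : 0 < b) (hc : 0 < c) (z : ℝ) :
    HasSum (fun k : ℕ => hyp12Coeff a b c k * z ^ k) (hyp12 a b c z) := (hasSum_hyp12 hb hc z).1

lemma summable_norm {a b c : ℝ} (hb : 0 < b) (hc : 0 < c) (z : ℝ) :
    Summable fun k : ℕ => ‖hyp12Coeff a b c k * z ^ k‖ := (hasSum hb hc z).summable.norm

lemma hyp12_zero (a b c : ℝ) : hyp12 a b c 0 = 1 := by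
  unfold hyp12
  rw [tsum_eq_single 0]
  · simp [hyp12Coeff]
  · intro k hk
    simp [hk]

lemma coeff_self {a : ℝ} (ha : 0 < a) (c : ℝ) (k : ℕ) :
    hyp12Coeff a a c k = 1 / ((k ! : ℝ) * (ascPochhammer ℝ k).eval c) := by
  have := (poch_pos ha k).ne'
  unfold hyp12Coeff
  rw [mul_right_comm, div_mul_cancel_right₀ this, one_div]

/-- Equal numerator and denominator parameters cancel, so `hyp12 1 1 c` serves throughout as ₀F₁(;
c; ·); the 1 is an arbitrary choice. -/
lemma hyp12_self {a : ℝ} (ha : 0 < a) (c z : ℝ) : hyp12 a a c z = hyp12 1 1 c z := by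
  unfold hyp12
  simp only [coeff_self ha, coeff_self one_pos]

lemma continuous_hyp12 {a b c : ℝ} (hb : 0 < b) (hc : 0 < c) : Continuous (hyp12 a b c) := by
  rw [continuous_iff_continuousAt]
  intro z
  have h : ContinuousOn (hyp12 a b c) (Metric.closedBall 0 (|z| + 1)) := by
    unfold hyp12
    refine continuousOn_tsum (fun k => by fun_prop) (summable_norm (a := a) hb hc (|z| + 1)) ?_
    intro k x hx
    rw [norm_mul, norm_mul, norm_pow, norm_pow]
    gcongr
    rw [mem_closedBall_zero_iff] at hx
    exact hx.trans (le_abs_self _)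
  refine h.continuousAt (Metric.closedBall_mem_nhds_of_mem ?_)
  simp

/-- The square of `₀F₁(; a + 1/2; ·)` is a `₁F₂`. -/
lemma hyp12_eq_sq {a : ℝ} (ha : 0 < a) (z : ℝ) :
    hyp12 a (a + 1 / 2) (2 * a) z = hyp12 1 1 (a + 1 / 2) (z / 4) ^ 2 := by
  have hd : 0 < a + 1 / 2 := by positivity
  have hs := summable_norm (a := 1) one_pos hd (z / 4)
  rw [sq]
  conv_rhs => unfold hyp12
  rw [tsum_mul_tsum_eq_tsum_sum_antidiagonal_of_summable_norm hs hs]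
  unfold hyp12
  congr 1
  ext n
  trans (∑ ij ∈ Finset.HasAntidiagonal.antidiagonal n, 1 / ((ij.1 ! : ℝ) * (ascPochhammer ℝ ij.1).eval (a + 1 / 2)) *
      (1 / ((ij.2 ! : ℝ) * (ascPochhammer ℝ ij.2).eval (a + 1 / 2)))) * (z / 4) ^ n
  · rw [sum_antidiagonal_inv_poch hd]
    have h1 := poch_two_mul a n
    have h2 := poch_add (2 * a) n n
    rw [← two_mul, h1] at h2
    have e0 := (poch_pos hd n).ne'
    have e1 := (poch_pos ha n).ne'
    have e2 := (poch_pos (show 0 < 2 * a by positivity) n).ne'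
    rw [show 2 * (a + 1 / 2) + (n : ℝ) - 1 = 2 * a + n by ring]
    have e3 : (ascPochhammer ℝ n).eval (2 * a + n) = 4 ^ n * (ascPochhammer ℝ n).eval a *
        (ascPochhammer ℝ n).eval (a + 1 / 2) / (ascPochhammer ℝ n).eval (2 * a) := by
      rw [h2]; field_simp
    rw [e3, div_pow, hyp12Coeff]
    have e4 : (4 : ℝ) ^ n ≠ 0 := by positivity
    field_simp
  · rw [Finset.sum_mul]
    refine Finset.sum_congr rfl fun ij hij => ?_
    rw [Finset.HasAntidiagonal.mem_antidiagonal] at hij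
    rw [coeff_self one_pos, coeff_self one_pos, ← hij, pow_add]
    ring

/-! ### Beta averages -/

lemma measurable_betaPDF (b q : ℝ) : Measurable (betaPDF b q) :=
  (measurable_betaPDFReal b q).ennreal_ofReal

lemma ae_mem_Ioo_beta (b q : ℝ) : ∀ᵐ t ∂betaMeasure b q, t ∈ Ioo (0 : ℝ) 1 := by
  rw [betaMeasure, ae_withDensity_iff (measurable_betaPDF b q)]
  refine Eventually.of_forall fun t ht => ?_
  by_contra h
  apply ht
  rw [mem_Ioo, not_and_or, not_lt, not_lt] at h
  rcases h with h | h
  · exact betaPDF_eq_zero_of_nonpos h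
  · exact betaPDF_eq_zero_of_one_le h

lemma betaPDFReal_nonneg {b q : ℝ} (hb : 0 < b) (hq : 0 < q) (t : ℝ) : 0 ≤ betaPDFReal b q t := by
  by_cases h : 0 < t ∧ t < 1
  · exact (betaPDFReal_pos h.1 h.2 hb hq).le
  · simp [betaPDFReal, h]

lemma integral_beta {E : Type*} [NormedAddCommGroup E] [NormedSpace ℝ E] {b q : ℝ} (hb : 0 < b)
    (hq : 0 < q) (f : ℝ → E) :
    ∫ t, f t ∂betaMeasure b q = ∫ t, betaPDFReal b q t • f t := by
  rw [betaMeasure, integral_withDensity_eq_integral_toReal_smul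
    (measurable_betaPDF b q) (by simp [betaPDF])]
  simp only [betaPDF, ENNReal.toReal_ofReal (betaPDFReal_nonneg hb hq _)]

lemma integrable_beta_iff {E : Type*} [NormedAddCommGroup E] [NormedSpace ℝ E] {b q : ℝ}
    (hb : 0 < b) (hq : 0 < q) {f : ℝ → E} :
    Integrable f (betaMeasure b q) ↔ Integrable fun t => betaPDFReal b q t • f t := by
  rw [betaMeasure, integrable_withDensity_iff_integrable_smul'
    (measurable_betaPDF b q) (by simp [betaPDF])]
  simp only [betaPDF, ENNReal.toReal_ofReal (betaPDFReal_nonneg hb hq _)]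

/-- The exponent r may be negative: moments of order -θ with θ < a are needed for the estimate of
the Laplace transform near 0. -/
lemma betaPDFReal_mul_rpow {b q r : ℝ} (hb : 0 < b) (hq : 0 < q) (hr : 0 < b + r) (t : ℝ) :
    betaPDFReal b q t * t ^ r = beta (b + r) q / beta b q * betaPDFReal (b + r) q t := by
  by_cases h : 0 < t ∧ t < 1
  · have h1 := (beta_pos hb hq).ne'
    have h2 := (beta_pos hr hq).ne'
    rw [betaPDFReal, betaPDFReal, if_pos h, if_pos h, show b + r - 1 = (b - 1) + r by ring,
      Real.rpow_add h.1]
    field_simp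
  · simp [betaPDFReal, h]

lemma integrable_betaPDFReal {b q : ℝ} (hb : 0 < b) (hq : 0 < q) :
    Integrable (betaPDFReal b q) := by
  have := isProbabilityMeasureBeta hb hq
  simpa using (integrable_beta_iff hb hq).1 (integrable_const (1 : ℝ))

lemma integral_betaPDFReal {b q : ℝ} (hb : 0 < b) (hq : 0 < q) :
    ∫ t, betaPDFReal b q t = 1 := by
  have := isProbabilityMeasureBeta hb hq
  simpa using (integral_beta hb hq (fun _ => (1 : ℝ))).symm

lemma integrable_rpow_beta {b q r : ℝ} (hb : 0 < b) (hq : 0 < q) (hr : 0 < b + r) :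
    Integrable (fun t : ℝ => t ^ r) (betaMeasure b q) := by
  rw [integrable_beta_iff hb hq]
  simp only [smul_eq_mul, betaPDFReal_mul_rpow hb hq hr]
  exact (integrable_betaPDFReal hr hq).const_mul _

lemma integral_rpow_beta {b q r : ℝ} (hb : 0 < b) (hq : 0 < q) (hr : 0 < b + r) :
    ∫ t, t ^ r ∂betaMeasure b q = beta (b + r) q / beta b q := by
  rw [integral_beta hb hq]
  simp only [smul_eq_mul, betaPDFReal_mul_rpow hb hq hr]
  rw [integral_const_mul, integral_betaPDFReal hr hq, mul_one]

lemma integrable_pow_beta {b q : ℝ} (hb : 0 < b) (hq : 0 < q) (k : ℕ) :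
    Integrable (fun t : ℝ => t ^ k) (betaMeasure b q) := by
  simpa using integrable_rpow_beta (r := k) hb hq (by positivity)

lemma integral_pow_beta {b q : ℝ} (hb : 0 < b) (hq : 0 < q) (k : ℕ) :
    ∫ t, t ^ k ∂betaMeasure b q =
      (ascPochhammer ℝ k).eval b / (ascPochhammer ℝ k).eval (b + q) := by
  have h := integral_rpow_beta (r := k) hb hq (by positivity)
  simp only [Real.rpow_natCast] at h
  rw [h, beta, beta, add_right_comm b k q, gamma_add_nat hb, gamma_add_nat (add_pos hb hq)]
  have h1 := (Real.Gamma_pos_of_pos hb).ne'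
  have h2 := (Real.Gamma_pos_of_pos hq).ne'
  have h3 := (Real.Gamma_pos_of_pos (add_pos hb hq)).ne'
  have h4 := (poch_pos (add_pos hb hq) k).ne'
  field_simp

/-- Raising a denominator parameter of `₁F₂` is averaging against a beta distribution. -/
lemma hyp12_add_eq_integral {a b c q : ℝ} (hb : 0 < b) (hc : 0 < c) (hq : 0 < q) (z : ℝ) :
    hyp12 a (b + q) c z = ∫ t, hyp12 a b c (t * z) ∂betaMeasure b q := by
  have := isProbabilityMeasureBeta hb hq
  have hint : ∀ k : ℕ, Integrable (fun t : ℝ => hyp12Coeff a b c k * (t * z) ^ k)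
      (betaMeasure b q) := by
    intro k
    simp only [mul_pow]
    exact ((integrable_pow_beta hb hq k).mul_const _).const_mul _
  have hcoeff : ∀ k : ℕ, hyp12Coeff a b c k * ((ascPochhammer ℝ k).eval b /
      (ascPochhammer ℝ k).eval (b + q)) = hyp12Coeff a (b + q) c k := by
    intro k
    have h1 := (poch_pos hb k).ne'
    unfold hyp12Coeff
    field_simp
  have hval : ∀ k : ℕ, ∫ t, hyp12Coeff a b c k * (t * z) ^ k ∂betaMeasure b q =
      hyp12Coeff a (b + q) c k * z ^ k := by
    intro k
    simp only [mul_pow]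
    rw [integral_const_mul, integral_mul_const, integral_pow_beta hb hq, ← hcoeff]
    ring
  have hnorm : ∀ k : ℕ, ∫ t, ‖hyp12Coeff a b c k * (t * z) ^ k‖ ∂betaMeasure b q =
      ‖hyp12Coeff a (b + q) c k * z ^ k‖ := by
    intro k
    rw [← hcoeff, ← integral_pow_beta hb hq]
    have e : ∀ᵐ t ∂betaMeasure b q, ‖hyp12Coeff a b c k * (t * z) ^ k‖ =
        ‖hyp12Coeff a b c k‖ * t ^ k * ‖z‖ ^ k := by
      filter_upwards [ae_mem_Ioo_beta b q] with t ht
      rw [mul_pow, norm_mul, norm_mul, norm_pow, norm_pow, Real.norm_of_nonneg ht.1.le]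
      ring
    have e0 : 0 ≤ ∫ t, t ^ k ∂betaMeasure b q := by
      refine integral_nonneg_of_ae ?_
      filter_upwards [ae_mem_Ioo_beta b q] with t ht
      exact pow_nonneg ht.1.le k
    rw [integral_congr_ae e, integral_mul_const, integral_const_mul, norm_mul, norm_mul, norm_pow,
      Real.norm_of_nonneg e0]
  have h := hasSum_integral_of_summable_integral_norm hint
    (by simp only [hnorm]; exact summable_norm (add_pos hb hq) hc z)
  simp only [hval] at h
  exact (hasSum (add_pos hb hq) hc z).unique h

lemma integrable_comp_mul_beta {f : ℝ → ℝ} (hf : Continuous f) {b q : ℝ} (hb : 0 < b) (hq : 0 < q)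
    (z : ℝ) : Integrable (fun t => f (t * z)) (betaMeasure b q) := by
  have := isProbabilityMeasureBeta hb hq
  obtain ⟨C, hC⟩ := (isCompact_Icc (a := (0 : ℝ)) (b := 1)).exists_bound_of_continuousOn
    (f := fun t => f (t * z)) (by fun_prop)
  refine Integrable.of_bound (by fun_prop) C ?_
  filter_upwards [ae_mem_Ioo_beta b q] with t ht
  exact hC t ⟨ht.1.le, ht.2.le⟩

/-- Nonnegativity on an initial interval becomes positivity when a denominator parameter is
raised. -/
lemma hyp12_pos_of_nonneg {a b b' c z : ℝ} (hb : 0 < b) (hbb : b < b') (hc : 0 < c)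
    (hz : 0 ≤ z) (h : ∀ s ∈ Ioo 0 z, 0 ≤ hyp12 a b c (-s)) : 0 < hyp12 a b' c (-z) := by
  rcases hz.eq_or_lt with rfl | hz
  · simp [hyp12_zero]
  have hq : 0 < b' - b := by linarith
  have hcont : Continuous (hyp12 a b c) := continuous_hyp12 hb hc
  have e := hyp12_add_eq_integral (a := a) hb hc hq (-z)
  rw [add_sub_cancel] at e
  have hnn : 0 ≤ᵐ[betaMeasure b (b' - b)] fun t => hyp12 a b c (t * -z) := by
    filter_upwards [ae_mem_Ioo_beta b (b' - b)] with t ht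
    have := h (t * z) ⟨mul_pos ht.1 hz, by nlinarith [ht.2]⟩
    simpa using this
  rw [e]
  refine lt_of_le_of_ne (integral_nonneg_of_ae hnn) fun h0 => ?_
  rw [eq_comm, integral_eq_zero_iff_of_nonneg_ae hnn (integrable_comp_mul_beta hcont hb hq _)] at h0
  -- A zero average would make the integrand vanish almost everywhere, but near t = 0 it is close to
  -- 1 and the beta density is positive there.
  have hpos : ∀ᶠ t in 𝓝[>] (0 : ℝ), 0 < hyp12 a b c (t * -z) := by
    have h1 : Tendsto (fun t => hyp12 a b c (t * -z)) (𝓝[>] 0) (𝓝 (hyp12 a b c (0 * -z))) :=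
      (Continuous.tendsto (by fun_prop) 0).mono_left nhdsWithin_le_nhds
    rw [zero_mul, hyp12_zero] at h1
    exact h1.eventually (lt_mem_nhds one_pos)
  obtain ⟨u, hu, hsub⟩ := (mem_nhdsGT_iff_exists_Ioo_subset).1 hpos
  rw [betaMeasure, EventuallyEq, ae_withDensity_iff
    (measurable_betaPDF b _)] at h0
  have h2 : ∀ᵐ t : ℝ, t ∉ Ioo 0 (min u 1) := by
    filter_upwards [h0] with t ht hmem
    have h3 : 0 < betaPDFReal b (b' - b) t :=
      betaPDFReal_pos hmem.1 (hmem.2.trans_le (min_le_right _ _)) hb hq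
    have h4 := ht (by simpa [betaPDF] using h3)
    have h5 := hsub ⟨hmem.1, hmem.2.trans_le (min_le_left _ _)⟩
    simp only [mem_ofPred_eq] at h5
    exact h5.ne' h4
  have h6 : volume (Ioo 0 (min u 1)) = 0 := by
    have := measure_eq_zero_iff_ae_notMem.2 h2
    exact this
  rw [Real.volume_Ioo] at h6
  simp only [sub_zero, ENNReal.ofReal_eq_zero, min_le_iff] at h6
  rcases h6 with h6 | h6
  · exact absurd hu (not_lt.2 h6)
  · linarith

/-! ### Zeros of Bessel functions -/

/-- Integrate termwise: Γ(c + k) cancels (c)_k and leaves an exponential series. The resulting decay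
as p → 0 is incompatible with a nonnegative integrand. -/
lemma integral_exp_mul_hyp12 {c p : ℝ} (hc : 0 < c) (hp : 0 < p) :
    ∫ z in Ioi (0 : ℝ), z ^ (c - 1) * Real.exp (-(p * z)) * hyp12 1 1 c (-z) =
      Real.Gamma c * ((1 / p) ^ c * Real.exp (-(1 / p))) := by
  have hexp : ∀ k : ℕ, ∀ z ∈ Ioi (0 : ℝ), z ^ (c - 1) * Real.exp (-(p * z)) * z ^ k =
      z ^ (c + k - 1) * Real.exp (-(p * z)) := by
    intro k z hz
    rw [add_sub_right_comm, Real.rpow_add hz, Real.rpow_natCast]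
    ring
  have hbase : ∀ k : ℕ, ∫ z in Ioi (0 : ℝ), z ^ (c - 1) * Real.exp (-(p * z)) * z ^ k =
      (1 / p) ^ c * (1 / p) ^ k * ((ascPochhammer ℝ k).eval c * Real.Gamma c) := by
    intro k
    rw [setIntegral_congr_fun measurableSet_Ioi (hexp k),
      Real.integral_rpow_mul_exp_neg_mul_Ioi (by positivity) hp, gamma_add_nat hc,
      Real.rpow_add (by positivity), Real.rpow_natCast]
  have hbint : ∀ k : ℕ, IntegrableOn (fun z : ℝ => z ^ (c - 1) * Real.exp (-(p * z)) * z ^ k)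
      (Ioi 0) := by
    intro k
    -- The integral of a non-integrable function is 0 by convention, so a nonzero value proves
    -- integrability.
    refine Integrable.of_integral_ne_zero ?_
    rw [hbase]
    have := poch_pos hc k
    have := Real.Gamma_pos_of_pos hc
    positivity
  have hF : ∀ k : ℕ, (fun z : ℝ => z ^ (c - 1) * Real.exp (-(p * z)) *
      (hyp12Coeff 1 1 c k * (-z) ^ k)) = fun z => (hyp12Coeff 1 1 c k * (-1) ^ k) *
        (z ^ (c - 1) * Real.exp (-(p * z)) * z ^ k) := by
    intro k
    ext z
    rw [neg_pow]
    ring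
  have hterm : ∀ k : ℕ, hyp12Coeff 1 1 c k * ((1 / p) ^ c * (1 / p) ^ k *
      ((ascPochhammer ℝ k).eval c * Real.Gamma c)) =
        Real.Gamma c * (1 / p) ^ c * ((1 / p) ^ k / k !) := by
    intro k
    have := (poch_pos hc k).ne'
    rw [coeff_self one_pos]
    field_simp
  have h := hasSum_integral_of_summable_integral_norm (μ := volume.restrict (Ioi 0))
    (F := fun (k : ℕ) (z : ℝ) => z ^ (c - 1) * Real.exp (-(p * z)) *
      (hyp12Coeff 1 1 c k * (-z) ^ k)) (fun k => by rw [hF]; exact (hbint k).const_mul _) ?_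
  · have e : ∀ z : ℝ, ∑' k : ℕ, z ^ (c - 1) * Real.exp (-(p * z)) *
        (hyp12Coeff 1 1 c k * (-z) ^ k) =
        z ^ (c - 1) * Real.exp (-(p * z)) * hyp12 1 1 c (-z) := by
      intro z
      rw [tsum_mul_left, hyp12]
    simp only [e, hF] at h
    refine h.unique ?_
    have h2 := (NormedSpace.expSeries_div_hasSum_exp (-(1 / p))).mul_left
      (Real.Gamma c * (1 / p) ^ c)
    rw [← Real.exp_eq_exp_ℝ, mul_assoc (Real.Gamma c)] at h2
    refine h2.congr_fun fun k => ?_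
    rw [integral_const_mul, hbase, mul_right_comm, hterm, neg_pow]
    ring
  · have e : ∀ k : ℕ, ∫ z in Ioi (0 : ℝ), ‖z ^ (c - 1) * Real.exp (-(p * z)) *
        (hyp12Coeff 1 1 c k * (-z) ^ k)‖ =
        Real.Gamma c * (1 / p) ^ c * ((1 / p) ^ k / k !) := by
      intro k
      rw [← hterm, ← hbase, ← integral_const_mul]
      refine setIntegral_congr_fun measurableSet_Ioi fun z hz => ?_
      have hz' : (0 : ℝ) < z := hz
      have := (coeff_pos one_pos one_pos hc k).le
      simp only [norm_mul, norm_pow, norm_neg, Real.norm_of_nonneg hz'.le, Real.norm_of_nonneg this,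
        Real.norm_of_nonneg (Real.exp_pos _).le, Real.norm_of_nonneg (Real.rpow_nonneg hz'.le _)]
      ring
    simp only [e]
    exact (Real.summable_pow_div_factorial _).mul_left _

/-- `₀F₁(; c; ·)` takes a negative value on the negative half-line. -/
lemma exists_hyp12_one_neg {c : ℝ} (hc : 0 < c) : ∃ s : ℝ, 0 < s ∧ hyp12 1 1 c (-s) < 0 := by
  by_contra! hnn
  have hG := Real.Gamma_pos_of_pos hc
  have hint : ∀ p : ℝ, 0 < p → IntegrableOn
      (fun z : ℝ => z ^ (c - 1) * Real.exp (-(p * z)) * hyp12 1 1 c (-z)) (Ioi 0) := by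
    intro p hp
    refine Integrable.of_integral_ne_zero ?_
    rw [integral_exp_mul_hyp12 hc hp]
    positivity
  -- For a nonnegative integrand the transform decreases in p; compare p = 1 with p = 1/u ≤ 1, then
  -- let u → ∞.
  have hle : ∀ u : ℝ, 1 ≤ u → Real.exp (-1) ≤ u ^ c * Real.exp (-1 * u) := by
    intro u hu
    have hu0 : 0 < u := by linarith
    have hp : 0 < 1 / u := by positivity
    have h := setIntegral_mono_on (hint 1 one_pos) (hint _ hp) measurableSet_Ioi fun z hz => by
      have hz' : (0 : ℝ) < z := hz
      have h1 : 1 / u ≤ 1 := by rw [div_le_one hu0]; exact hu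
      have h2 := hnn z hz
      gcongr
    rw [integral_exp_mul_hyp12 hc one_pos, integral_exp_mul_hyp12 hc hp] at h
    have := le_of_mul_le_mul_left h hG
    simpa using this
  have hlim := tendsto_rpow_mul_exp_neg_mul_atTop_nhds_zero c 1 one_pos
  have hev := (hlim.eventually (gt_mem_nhds (Real.exp_pos (-1)))).and (eventually_ge_atTop 1)
  obtain ⟨u, hu, hu1⟩ := hev.exists
  exact absurd (hle u hu1) (not_le.2 hu)

lemma exists_hyp12_neg_of_le {a b c : ℝ} (hb : 0 < b) (hc : 0 < c) (hba : b ≤ a) :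
    ∃ s : ℝ, 0 < s ∧ hyp12 a b c (-s) < 0 := by
  have ha : 0 < a := by linarith
  obtain ⟨s, hs, hneg⟩ := exists_hyp12_one_neg hc
  rw [← hyp12_self ha] at hneg
  rcases hba.eq_or_lt with rfl | hlt
  · exact ⟨s, hs, hneg⟩
  · by_contra! hnn
    exact absurd (hyp12_pos_of_nonneg hb hlt hc hs.le fun t ht => hnn t ht.1) (not_lt.2 hneg.le)

lemma besselJ_eq {α x : ℝ} (hα : -1 < α) (hx : 0 < x) :
    besselJ α x = (x / 2) ^ α / Real.Gamma (α + 1) * hyp12 1 1 (α + 1) (-(x ^ 2 / 4)) := by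
  have hα1 : 0 < α + 1 := by linarith
  unfold besselJ hyp12
  rw [← tsum_mul_left]
  congr 1
  ext k
  have h1 := (poch_pos hα1 k).ne'
  have h2 := (Real.Gamma_pos_of_pos hα1).ne'
  rw [coeff_self one_pos, show (k : ℝ) + α + 1 = (α + 1) + k by ring, gamma_add_nat hα1,
    Real.rpow_add (by positivity), show (2 : ℝ) * k = ((2 * k : ℕ) : ℝ) by push_cast; ring,
    Real.rpow_natCast, pow_mul, neg_pow (x ^ 2 / 4), div_pow x 2 2]
  norm_num
  field_simp

lemma besselZero_spec {α : ℝ} (hα : -1 < α) :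
    0 < besselZero α ∧ hyp12 1 1 (α + 1) (-(besselZero α ^ 2 / 4)) = 0 := by
  have hα1 : 0 < α + 1 := by linarith
  have hcont : Continuous fun x : ℝ => hyp12 1 1 (α + 1) (-(x ^ 2 / 4)) :=
    (continuous_hyp12 one_pos hα1).comp (by fun_prop)
  -- Admitting x = 0 adds no element, as the series equals 1 there, and makes the set visibly
  -- closed, so that its infimum is attained.
  have hset : {x : ℝ | 0 < x ∧ besselJ α x = 0} =
      {x : ℝ | 0 ≤ x ∧ hyp12 1 1 (α + 1) (-(x ^ 2 / 4)) = 0} := by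
    ext x
    simp only [mem_ofPred_eq]
    constructor
    · rintro ⟨hx, h⟩
      rw [besselJ_eq hα hx, mul_eq_zero] at h
      have h1 := Real.Gamma_pos_of_pos hα1
      exact ⟨hx.le, h.resolve_left (by positivity)⟩
    · rintro ⟨hx, h⟩
      rcases hx.eq_or_lt with rfl | hx
      · simp [hyp12_zero] at h
      · exact ⟨hx, by rw [besselJ_eq hα hx, h, mul_zero]⟩
  have hclosed : IsClosed {x : ℝ | 0 ≤ x ∧ hyp12 1 1 (α + 1) (-(x ^ 2 / 4)) = 0} :=
    isClosed_Ici.inter (isClosed_eq hcont continuous_const)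
  have hne : {x : ℝ | 0 ≤ x ∧ hyp12 1 1 (α + 1) (-(x ^ 2 / 4)) = 0}.Nonempty := by
    obtain ⟨s, hs, hneg⟩ := exists_hyp12_one_neg hα1
    have h2 : (2 * √s) ^ 2 / 4 = s := by rw [mul_pow, Real.sq_sqrt hs.le]; ring
    have hpos : (0 : ℝ) ≤ 2 * √s := by positivity
    have h := intermediate_value_Icc' hpos hcont.continuousOn
    have h0 : (0 : ℝ) ∈ Icc (hyp12 1 1 (α + 1) (-((2 * √s) ^ 2 / 4)))
        (hyp12 1 1 (α + 1) (-((0 : ℝ) ^ 2 / 4))) := by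
      rw [h2]
      exact ⟨hneg.le, by simp [hyp12_zero]⟩
    obtain ⟨x, hx, hx0⟩ := h h0
    exact ⟨x, hx.1, hx0⟩
  have hmem := hclosed.csInf_mem hne ⟨0, fun x hx => hx.1⟩
  rw [← hset, ← besselZero] at hmem
  have h : besselZero α ∈ {x : ℝ | 0 ≤ x ∧ hyp12 1 1 (α + 1) (-(x ^ 2 / 4)) = 0} := by
    rw [← hset]
    exact hmem
  exact ⟨hmem.1, h.2⟩

/-! ### Sign changes and zeros of `₁F₂` -/

lemma alternates_of_neg {a b c s : ℝ} (hb : 0 < b) (hc : 0 < c) (hs : 0 < s)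
    (hneg : hyp12 a b c (-s) < 0) :
    AlternatesInSign (fun x : ℝ => hyp12 a b c (-(x ^ 2 / 4))) ∧
      ∃ x ∈ Ioo (0 : ℝ) (2 * √s), hyp12 a b c (-(x ^ 2 / 4)) = 0 := by
  have hcont : Continuous fun x : ℝ => hyp12 a b c (-(x ^ 2 / 4)) :=
    (continuous_hyp12 hb hc).comp (by fun_prop)
  have h2 : (2 * √s) ^ 2 / 4 = s := by rw [mul_pow, Real.sq_sqrt hs.le]; ring
  have hpos : (0 : ℝ) < 2 * √s := by positivity
  refine ⟨⟨⟨2 * √s, hpos, by simpa only [h2] using hneg⟩, ?_⟩, ?_⟩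
  · have h1 : Tendsto (fun x : ℝ => hyp12 a b c (-(x ^ 2 / 4))) (𝓝[>] 0)
        (𝓝 (hyp12 a b c (-((0 : ℝ) ^ 2 / 4)))) := (hcont.tendsto 0).mono_left nhdsWithin_le_nhds
    have h0 : hyp12 a b c (-((0 : ℝ) ^ 2 / 4)) = 1 := by simp [hyp12_zero]
    rw [h0] at h1
    obtain ⟨x, hx, hx0⟩ := ((h1.eventually (lt_mem_nhds one_pos)).and self_mem_nhdsWithin).exists
    exact ⟨x, hx0, hx⟩
  · have h := intermediate_value_Ioo' hpos.le hcont.continuousOn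
    have h0 : (0 : ℝ) ∈ Ioo (hyp12 a b c (-((2 * √s) ^ 2 / 4)))
        (hyp12 a b c (-((0 : ℝ) ^ 2 / 4))) := by
      rw [h2]
      exact ⟨hneg, by simp [hyp12_zero]⟩
    obtain ⟨x, hx, hx0⟩ := h h0
    exact ⟨x, hx, hx0⟩

lemma two_mul_sqrt_lt {s X : ℝ} (hX : 0 < X) (h : s < X ^ 2 / 4) : 2 * √s < X := by
  have h1 : √s < X / 2 := by
    rw [Real.sqrt_lt' (by positivity)]
    linarith
  linarith

/-- For b = a the function is the Bessel one and its zero is j_{c-1} itself, hence the closed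
endpoint. For b < a, nonnegativity before j_{c-1} would make ₀F₁ positive at its own zero. -/
lemma alternates_of_le {a b c : ℝ} (hb : 0 < b) (hc : 0 < c) (hba : b ≤ a) :
    AlternatesInSign (fun x : ℝ => hyp12 a b c (-(x ^ 2 / 4))) ∧
      ∃ x ∈ Ioc (0 : ℝ) (besselZero (c - 1)), hyp12 a b c (-(x ^ 2 / 4)) = 0 := by
  have ha : 0 < a := by linarith
  obtain ⟨hj, hj0⟩ := besselZero_spec (α := c - 1) (by linarith)
  rw [sub_add_cancel, ← hyp12_self ha] at hj0
  obtain ⟨s, hs, hneg⟩ := exists_hyp12_neg_of_le hb hc hba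
  refine ⟨(alternates_of_neg hb hc hs hneg).1, ?_⟩
  rcases hba.eq_or_lt with rfl | hlt
  · exact ⟨_, ⟨hj, le_rfl⟩, hj0⟩
  · have : ∃ t ∈ Ioo 0 (besselZero (c - 1) ^ 2 / 4), hyp12 a b c (-t) < 0 := by
      by_contra! hnn
      exact (hyp12_pos_of_nonneg hb hlt hc (by positivity) hnn).ne' hj0
    obtain ⟨t, ht, htneg⟩ := this
    obtain ⟨x, hx, hx0⟩ := (alternates_of_neg hb hc ht.1 htneg).2
    exact ⟨x, ⟨hx.1, (hx.2.trans (two_mul_sqrt_lt hj ht.2)).le⟩, hx0⟩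

lemma alternates_of_le_two_mul {a b c : ℝ} (ha : 0 < a) (hb : 0 < b) (hc : 0 < c)
    (hb1 : b ≤ a + 1 / 2) (hc1 : c ≤ 2 * a) (hbc : b + c < 3 * a + 1 / 2) :
    AlternatesInSign (fun x : ℝ => hyp12 a b c (-(x ^ 2 / 4))) ∧
      ∃ x ∈ Ioo (0 : ℝ) (2 * besselZero (a - 1 / 2)), hyp12 a b c (-(x ^ 2 / 4)) = 0 := by
  obtain ⟨hj, hj0⟩ := besselZero_spec (α := a - 1 / 2) (by linarith)
  set j := besselZero (a - 1 / 2)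
  have hzero : hyp12 a (a + 1 / 2) (2 * a) (-(j ^ 2)) = 0 := by
    rw [hyp12_eq_sq ha, neg_div, show a + 1 / 2 = a - 1 / 2 + 1 by ring, hj0]
    simp
  have hj2 : 0 < j ^ 2 := by positivity
  have : ∃ t ∈ Ioo 0 (j ^ 2), hyp12 a b c (-t) < 0 := by
    by_contra! hnn
    -- The strict bound on b + c guarantees that at least one of the two parameters is really
    -- raised; this makes the square strictly positive at its zero.
    rcases hb1.eq_or_lt with rfl | hb2
    · have hc2 : c < 2 * a := by linarith
      have h1 := hyp12_pos_of_nonneg (a := a) (b := c) (c := a + 1 / 2) hc hc2 hb hj2.le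
        fun t ht => by rw [hyp12_symm]; exact hnn t ht
      rw [hyp12_symm, hzero] at h1
      exact lt_irrefl _ h1
    · have h1 : ∀ t ∈ Ioo 0 (j ^ 2), 0 ≤ hyp12 a (a + 1 / 2) c (-t) := fun t ht =>
        (hyp12_pos_of_nonneg hb hb2 hc ht.1.le fun s hs => hnn s ⟨hs.1, hs.2.trans ht.2⟩).le
      rcases hc1.eq_or_lt with rfl | hc2
      · exact (hyp12_pos_of_nonneg hb hb2 hc hj2.le hnn).ne' hzero
      · have h2 := hyp12_pos_of_nonneg (a := a) (b := c) (c := a + 1 / 2) hc hc2 (by positivity)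
          hj2.le fun t ht => by rw [hyp12_symm]; exact h1 t ht
        rw [hyp12_symm, hzero] at h2
        exact lt_irrefl _ h2
  obtain ⟨t, ht, htneg⟩ := this
  obtain ⟨h1, x, hx, hx0⟩ := alternates_of_neg hb hc ht.1 htneg
  exact ⟨h1, x, ⟨hx.1, hx.2.trans (two_mul_sqrt_lt (by positivity)
    (by rw [mul_pow]; linarith [ht.2]))⟩, hx0⟩

/-! ### A polynomial bound for `₀F₁` on the negative half-line -/

lemma hyp12_half_eq_cos (x : ℝ) : hyp12 1 1 (1 / 2) (-(x ^ 2 / 4)) = Real.cos x := by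
  refine (hasSum one_pos (by norm_num) _).unique ((Real.hasSum_cos x).congr_fun fun k => ?_)
  have h := poch_two_mul (1 / 2) k
  rw [show (2 : ℝ) * (1 / 2) = 1 by norm_num, show (1 / 2 + 1 / 2 : ℝ) = 1 by norm_num,
    ascPochhammer_eval_one, ascPochhammer_eval_one] at h
  have h1 := (poch_pos (show (0 : ℝ) < 1 / 2 by norm_num) k).ne'
  rw [coeff_self one_pos, neg_pow (x ^ 2 / 4), h, div_pow, pow_mul]
  field_simp

/-- For b = 1/2 the function is a cosine; larger b are beta averages of it. -/
lemma abs_hyp12_one_le_one {b y : ℝ} (hb : 1 / 2 ≤ b) (hy : 0 ≤ y) :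
    |hyp12 1 1 b (-y)| ≤ 1 := by
  have hcos : ∀ y : ℝ, 0 ≤ y → |hyp12 1 1 (1 / 2) (-y)| ≤ 1 := by
    intro y hy
    have h : y = (2 * √y) ^ 2 / 4 := by rw [mul_pow, Real.sq_sqrt hy]; ring
    rw [h, hyp12_half_eq_cos]
    exact Real.abs_cos_le_one _
  rcases hb.eq_or_lt with rfl | hb
  · exact hcos y hy
  · have hq : 0 < b - 1 / 2 := by linarith
    have := isProbabilityMeasureBeta (show (0 : ℝ) < 1 / 2 by norm_num) hq
    have e := hyp12_add_eq_integral (a := 1) (b := 1 / 2) (c := 1) (by norm_num) one_pos hq (-y)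
    rw [add_sub_cancel] at e
    rw [hyp12_symm, e, ← Real.norm_eq_abs]
    refine (norm_integral_le_of_norm_le_const (C := 1) ?_).trans (by rw [probReal_univ, one_mul])
    filter_upwards [ae_mem_Ioo_beta (1 / 2) (b - 1 / 2)] with t ht
    rw [hyp12_symm, Real.norm_eq_abs, mul_neg]
    exact hcos _ (mul_nonneg ht.1.le hy)

lemma hyp12_one_contiguous {b : ℝ} (hb : 0 < b) (z : ℝ) :
    hyp12 1 1 b z = hyp12 1 1 (b + 1) z + z / (b * (b + 1)) * hyp12 1 1 (b + 2) z := by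
  have h0 := hasSum (a := 1) one_pos hb z
  have h1 := hasSum (a := 1) one_pos (show 0 < b + 1 by positivity) z
  have h2 := (hasSum (a := 1) one_pos (show 0 < b + 2 by positivity) z).mul_left
    (z / (b * (b + 1)))
  have h3 := h0.sub h1
  rw [← hasSum_nat_add_iff' 1] at h3
  have hval := h3.unique (h2.congr_fun fun k => by
    have e1 := poch_add b 1 k
    have e2 := poch_add (b + 1) 1 k
    have e3 := ascPochhammer_succ_eval (S := ℝ) k b
    have e4 := ascPochhammer_succ_eval (S := ℝ) k (b + 1)
    simp only [ascPochhammer_one, Polynomial.eval_X, Nat.cast_one] at e1 e2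
    rw [add_comm 1 k] at e1 e2
    rw [show b + 1 + 1 = b + 2 by ring] at e2
    have p2 := (poch_pos (show 0 < b + 2 by positivity) k).ne'
    have hk : b + 1 + (k : ℝ) ≠ 0 := by positivity
    have e5 : (ascPochhammer ℝ k).eval (b + 1) =
        (b + 1) * (ascPochhammer ℝ k).eval (b + 2) / (b + 1 + k) := by
      rw [eq_div_iff hk, ← e4, e2]
    rw [coeff_self one_pos, coeff_self one_pos, coeff_self one_pos, e1, e2, e5, Nat.factorial_succ]
    push_cast
    have hk1 : (k : ℝ) + 1 ≠ 0 := by positivity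
    have hb1 : b + 1 ≠ 0 := by positivity
    field_simp
    ring)
  simp only [Finset.sum_range_one, pow_zero, mul_one, hyp12Coeff, ascPochhammer_zero,
    Polynomial.eval_one, Nat.factorial_zero, Nat.cast_one, sub_self, sub_zero] at hval
  linarith

/-- The contiguous relation trades b for b + 1 and b + 2, both above 1/2. Polynomial growth is all
that the Laplace transform needs. -/
lemma abs_hyp12_one_le {b y : ℝ} (hb : 0 < b) (hy : 0 ≤ y) :
    |hyp12 1 1 b (-y)| ≤ 1 + y / (b * (b + 1)) := by
  rw [hyp12_one_contiguous hb]
  refine (abs_add_le _ _).trans (add_le_add (abs_hyp12_one_le_one (by linarith) hy) ?_)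
  rw [abs_mul, neg_div, abs_neg, abs_of_nonneg (show 0 ≤ y / (b * (b + 1)) by positivity)]
  exact mul_le_of_le_one_right (by positivity) (abs_hyp12_one_le_one (by linarith) hy)

/-! ### Laplace transforms -/

/-- The Laplace transform of a function of subexponential growth is holomorphic on the right
half-plane. -/
lemma differentiableOn_laplace {g : ℝ → ℝ}
    (hg : ∀ ε : ℝ, 0 < ε → IntegrableOn (fun x => Real.exp (-(ε * x)) * g x) (Ioi 0)) :
    DifferentiableOn ℂ (fun p : ℂ => ∫ x in Ioi (0 : ℝ), Complex.exp (-(p * x)) * g x)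
      {p : ℂ | 0 < p.re} := by
  intro p hp
  have hp' : 0 < p.re := hp
  have hmeas : AEStronglyMeasurable g (volume.restrict (Ioi 0)) := by
    have h := (hg 1 one_pos).aestronglyMeasurable
    have h2 : AEStronglyMeasurable (fun x : ℝ => Real.exp (1 * x)) (volume.restrict (Ioi 0)) := by
      fun_prop
    refine (h2.mul h).congr (Eventually.of_forall fun x => ?_)
    simp only [Pi.mul_apply]
    rw [← mul_assoc, ← Real.exp_add]
    simp
  have hmeasC : AEStronglyMeasurable (fun x => (g x : ℂ)) (volume.restrict (Ioi 0)) :=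
    Complex.continuous_ofReal.comp_aestronglyMeasurable hmeas
  have hnorm : ∀ (q : ℂ) (x : ℝ), ‖Complex.exp (-(q * x))‖ = Real.exp (-(q.re * x)) := by
    intro q x
    rw [Complex.norm_exp]
    simp
  -- On Re q > 2δ the kernel is at most exp(-δx)²; one factor absorbs the x produced by
  -- differentiation, the other gives the integrable bound.
  set δ := p.re / 4 with hδ
  have hδ0 : 0 < δ := by positivity
  have hs : {q : ℂ | 2 * δ < q.re} ∈ 𝓝 p :=
    (isOpen_lt continuous_const Complex.continuous_re).mem_nhds (by
      change 2 * δ < p.re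
      linarith)
  refine (hasDerivAt_integral_of_dominated_loc_of_deriv_le (𝕜 := ℂ)
    (F' := fun q x => Complex.exp (-(q * x)) * (-x) * g x)
    (bound := fun x => δ⁻¹ * ‖Real.exp (-(δ * x)) * g x‖) hs
    (Eventually.of_forall fun q => ?_) ?_ ?_ ?_ ?_ ?_).2.differentiableAt.differentiableWithinAt
  · exact AEStronglyMeasurable.mul (by fun_prop) hmeasC
  · refine ((hg p.re hp').norm).mono' (AEStronglyMeasurable.mul (by fun_prop) hmeasC)
      (Eventually.of_forall fun x => ?_)
    rw [norm_mul, norm_mul, hnorm, Complex.norm_real, Real.norm_of_nonneg (Real.exp_pos _).le]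
  · exact AEStronglyMeasurable.mul (by fun_prop) hmeasC
  · filter_upwards [ae_restrict_mem measurableSet_Ioi] with x hx q hq
    have hx' : (0 : ℝ) < x := hx
    have hq' : 2 * δ < q.re := hq
    rw [norm_mul, norm_mul, hnorm, norm_neg, Complex.norm_real, Complex.norm_real, norm_mul,
      Real.norm_of_nonneg (Real.exp_pos _).le, Real.norm_of_nonneg hx'.le, ← mul_assoc]
    refine mul_le_mul_of_nonneg_right ?_ (norm_nonneg _)
    have h1 : Real.exp (-(q.re * x)) ≤ Real.exp (-(δ * x)) * Real.exp (-(δ * x)) := by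
      rw [← Real.exp_add, Real.exp_le_exp]
      nlinarith
    have h2 : x * Real.exp (-(δ * x)) ≤ δ⁻¹ := by
      have h3 := Real.add_one_le_exp (δ * x)
      rw [Real.exp_neg, ← div_eq_mul_inv, div_le_iff₀ (Real.exp_pos _), inv_mul_eq_div,
        le_div_iff₀ hδ0]
      linarith
    calc Real.exp (-(q.re * x)) * x ≤ Real.exp (-(δ * x)) * Real.exp (-(δ * x)) * x := by gcongr
      _ = x * Real.exp (-(δ * x)) * Real.exp (-(δ * x)) := by ring
      _ ≤ δ⁻¹ * Real.exp (-(δ * x)) := by gcongr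
  · exact ((hg δ hδ0).norm).const_mul _
  · refine Eventually.of_forall fun x q _ => ?_
    have h1 : HasDerivAt (fun q : ℂ => -(q * x)) (-(1 * x)) q := ((hasDerivAt_id q).mul_const _).neg
    have h2 := (h1.cexp).mul_const (g x : ℂ)
    rwa [one_mul] at h2

lemma hasSum_one_sub_rpow (m : ℝ) {w : ℝ} (hw : |w| < 1) :
    HasSum (fun k : ℕ => (ascPochhammer ℝ k).eval m / k ! * w ^ k) (1 / (1 - w) ^ m) := by
  have h := (Real.one_div_one_sub_rpow_hasFPowerSeriesOnBall_zero m).hasSum (y := w) (by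
    simpa [← ofReal_norm, Real.norm_eq_abs] using hw)
  simp only [FormalMultilinearSeries.ofScalars_apply_eq, smul_eq_mul, zero_add] at h
  refine h.congr_fun fun k => ?_
  have h1 := choose_mul_factorial (m + k - 1) k
  rw [show m + (k : ℝ) - 1 - k + 1 = m by ring] at h1
  rw [← h1]
  have : (k ! : ℝ) ≠ 0 := by positivity
  field_simp

/-- By duplication Γ(2b + 2k) contains (b)_k (b + 1/2)_k; the first factor cancels and a binomial
series in -t/p² remains. The condition p > 1 makes it converge for all t in [0, 1]. -/
lemma integral_exp_mul_rpow_mul_hyp12 {b p t : ℝ} (hb : 0 < b) (hp : 1 < p)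
    (ht : t ∈ Icc (0 : ℝ) 1) :
    ∫ x in Ioi (0 : ℝ), Real.exp (-(p * x)) *
      (x ^ (2 * b - 1) * hyp12 1 1 b (-(t * (x ^ 2 / 4)))) =
      Real.Gamma (2 * b) * p * (p ^ 2 + t) ^ (-(b + 1 / 2)) := by
  have hp0 : 0 < p := by linarith
  have hexp : ∀ k : ℕ, ∀ x ∈ Ioi (0 : ℝ), Real.exp (-(p * x)) * x ^ (2 * b - 1) * x ^ (2 * k) =
      x ^ (2 * b + (2 * k : ℕ) - 1) * Real.exp (-(p * x)) := by
    intro k x hx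
    rw [add_sub_right_comm, Real.rpow_add hx, Real.rpow_natCast]
    ring
  have hbase : ∀ k : ℕ, ∫ x in Ioi (0 : ℝ), Real.exp (-(p * x)) * x ^ (2 * b - 1) * x ^ (2 * k) =
      (1 / p) ^ (2 * b) * (1 / p) ^ (2 * k) * (4 ^ k * (ascPochhammer ℝ k).eval b *
        (ascPochhammer ℝ k).eval (b + 1 / 2) * Real.Gamma (2 * b)) := by
    intro k
    rw [setIntegral_congr_fun measurableSet_Ioi (hexp k),
      Real.integral_rpow_mul_exp_neg_mul_Ioi (by positivity) hp0, gamma_add_nat (by positivity),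
      Real.rpow_add (by positivity), Real.rpow_natCast, poch_two_mul]
  have hbint : ∀ k : ℕ, IntegrableOn
      (fun x : ℝ => Real.exp (-(p * x)) * x ^ (2 * b - 1) * x ^ (2 * k)) (Ioi 0) := by
    intro k
    refine Integrable.of_integral_ne_zero ?_
    rw [hbase]
    have := poch_pos hb k
    have := poch_pos (show 0 < b + 1 / 2 by positivity) k
    have := Real.Gamma_pos_of_pos (show 0 < 2 * b by positivity)
    positivity
  have hF : ∀ k : ℕ, (fun x : ℝ => Real.exp (-(p * x)) * x ^ (2 * b - 1) *
      (hyp12Coeff 1 1 b k * (-(t * (x ^ 2 / 4))) ^ k)) =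
      fun x => (hyp12Coeff 1 1 b k * (-1) ^ k * (t / 4) ^ k) *
        (Real.exp (-(p * x)) * x ^ (2 * b - 1) * x ^ (2 * k)) := by
    intro k
    ext x
    rw [neg_pow, mul_div_left_comm, mul_pow, pow_mul]
    ring
  have hterm : ∀ k : ℕ, hyp12Coeff 1 1 b k * (t / 4) ^ k * ((1 / p) ^ (2 * b) * (1 / p) ^ (2 * k) *
      (4 ^ k * (ascPochhammer ℝ k).eval b *
        (ascPochhammer ℝ k).eval (b + 1 / 2) * Real.Gamma (2 * b))) =
        Real.Gamma (2 * b) * (1 / p) ^ (2 * b) *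
          ((ascPochhammer ℝ k).eval (b + 1 / 2) / k ! * (t / p ^ 2) ^ k) := by
    intro k
    have := (poch_pos hb k).ne'
    rw [coeff_self one_pos, pow_mul, div_pow t, div_pow t, div_pow 1 p, one_pow, div_pow 1 (p ^ 2),
      one_pow]
    field_simp
  have hw : |t / p ^ 2| < 1 := by
    rw [abs_of_nonneg (div_nonneg ht.1 (by positivity)), div_lt_one (by positivity)]
    nlinarith [ht.2]
  have h := hasSum_integral_of_summable_integral_norm (μ := volume.restrict (Ioi 0))
    (F := fun (k : ℕ) (x : ℝ) => Real.exp (-(p * x)) * x ^ (2 * b - 1) *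
      (hyp12Coeff 1 1 b k * (-(t * (x ^ 2 / 4))) ^ k))
      (fun k => by rw [hF]; exact (hbint k).const_mul _) ?_
  · have e : ∀ x : ℝ, ∑' k : ℕ, Real.exp (-(p * x)) * x ^ (2 * b - 1) *
        (hyp12Coeff 1 1 b k * (-(t * (x ^ 2 / 4))) ^ k) =
        Real.exp (-(p * x)) * (x ^ (2 * b - 1) * hyp12 1 1 b (-(t * (x ^ 2 / 4)))) := by
      intro x
      rw [tsum_mul_left, hyp12, mul_assoc]
    simp only [e, hF] at h
    refine h.unique ?_
    have h2 := (hasSum_one_sub_rpow (b + 1 / 2) (w := -(t / p ^ 2)) (by rwa [abs_neg])).mul_left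
      (Real.Gamma (2 * b) * (1 / p) ^ (2 * b))
    have e2 : Real.Gamma (2 * b) * (1 / p) ^ (2 * b) * (1 / (1 - -(t / p ^ 2)) ^ (b + 1 / 2)) =
        Real.Gamma (2 * b) * p * (p ^ 2 + t) ^ (-(b + 1 / 2)) := by
      have h3 : p ^ 2 + t = p ^ 2 * (1 - -(t / p ^ 2)) := by field_simp; ring
      have h4 : 0 ≤ 1 - -(t / p ^ 2) := by
        have := ht.1
        rw [sub_neg_eq_add]
        positivity
      rw [h3, Real.mul_rpow (by positivity) h4, Real.rpow_neg h4, one_div p, Real.inv_rpow hp0.le,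
        ← Real.rpow_neg hp0.le, ← Real.rpow_natCast p 2, ← Real.rpow_mul hp0.le]
      rw [show p ^ (-(2 * b)) = p * p ^ (((2 : ℕ) : ℝ) * -(b + 1 / 2)) by
        conv_rhs => rw [← Real.rpow_one_add' hp0.le (by push_cast; linarith)]
        congr 1
        push_cast
        ring]
      ring
    rw [e2] at h2
    refine h2.congr_fun fun k => ?_
    rw [integral_const_mul, hbase, neg_pow (t / p ^ 2), mul_left_comm _ ((-1) ^ k),
      mul_left_comm _ ((-1) ^ k), ← hterm]
    ring
  · have e : ∀ k : ℕ, ∫ x in Ioi (0 : ℝ), ‖Real.exp (-(p * x)) * x ^ (2 * b - 1) *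
        (hyp12Coeff 1 1 b k * (-(t * (x ^ 2 / 4))) ^ k)‖ =
        Real.Gamma (2 * b) * (1 / p) ^ (2 * b) *
          ((ascPochhammer ℝ k).eval (b + 1 / 2) / k ! * (t / p ^ 2) ^ k) := by
      intro k
      rw [← hterm, ← hbase, ← integral_const_mul]
      refine setIntegral_congr_fun measurableSet_Ioi fun x hx => ?_
      have hx' : (0 : ℝ) < x := hx
      have h1 := (coeff_pos one_pos one_pos hb k).le
      have h2 : 0 ≤ t * (x ^ 2 / 4) := mul_nonneg ht.1 (by positivity)
      simp only [norm_mul, norm_pow, norm_neg, Real.norm_of_nonneg h1,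
        Real.norm_of_nonneg (Real.exp_pos _).le, Real.norm_of_nonneg (Real.rpow_nonneg hx'.le _)]
      rw [← norm_mul, Real.norm_of_nonneg h2, pow_mul, mul_div_left_comm, mul_pow]
      ring
    simp only [e]
    exact (hasSum_one_sub_rpow (b + 1 / 2) hw).summable.mul_left _

lemma integrableOn_exp_mul_rpow {s ε : ℝ} (hs : 0 < s) (hε : 0 < ε) :
    IntegrableOn (fun x : ℝ => Real.exp (-(ε * x)) * x ^ (s - 1)) (Ioi 0) := by
  refine Integrable.of_integral_ne_zero ?_
  simp only [mul_comm (Real.exp _)]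
  rw [Real.integral_rpow_mul_exp_neg_mul_Ioi hs hε]
  have := Real.Gamma_pos_of_pos hs
  positivity

lemma integrableOn_exp_mul_rpow_mul_quadratic {b ε : ℝ} (C : ℝ) (hb : 0 < b) (hε : 0 < ε) :
    IntegrableOn (fun x : ℝ => Real.exp (-(ε * x)) * (x ^ (2 * b - 1) * (1 + C * x ^ 2)))
      (Ioi 0) := by
  have h1 := integrableOn_exp_mul_rpow (s := 2 * b) (by positivity) hε
  have h2 := (integrableOn_exp_mul_rpow (s := 2 * b + 2) (by positivity) hε).const_mul C
  refine (h1.add h2).congr_fun (fun x hx => ?_) measurableSet_Ioi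
  simp only [Pi.add_apply]
  rw [add_sub_right_comm, Real.rpow_add hx, Real.rpow_two]
  ring

lemma abs_hyp12_one_le_quadratic {b t x : ℝ} (hb : 0 < b) (ht : t ∈ Icc (0 : ℝ) 1) :
    |hyp12 1 1 b (-(t * (x ^ 2 / 4)))| ≤ 1 + 1 / (4 * (b * (b + 1))) * x ^ 2 := by
  refine (abs_hyp12_one_le hb (mul_nonneg ht.1 (by positivity))).trans ?_
  have : t * (x ^ 2 / 4) ≤ x ^ 2 / 4 := mul_le_of_le_one_left (by positivity) ht.2
  calc 1 + t * (x ^ 2 / 4) / (b * (b + 1)) ≤ 1 + x ^ 2 / 4 / (b * (b + 1)) := by gcongr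
    _ = _ := by field_simp

lemma sq_add_mem_slitPlane {p : ℂ} (hp : 0 < p.re) {t : ℝ} (ht : 0 ≤ t) :
    p ^ 2 + t ∈ Complex.slitPlane := by
  rw [Complex.mem_slitPlane_iff]
  by_cases hi : p.im = 0
  · left
    simp only [sq, Complex.add_re, Complex.mul_re, hi, Complex.ofReal_re]
    nlinarith
  · right
    simp only [sq, Complex.add_im, Complex.mul_im, Complex.ofReal_im]
    have := mul_ne_zero hp.ne' hi
    intro h
    apply this
    linarith

/-- The Laplace transform of `x ^ (2 b - 1) ₀F₁(; b; -t x² / 4)`. -/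
lemma laplace_rpow_mul_hyp12_one {b t : ℝ} (hb : 0 < b) (ht : t ∈ Icc (0 : ℝ) 1) {p : ℂ}
    (hp : 0 < p.re) :
    ∫ x in Ioi (0 : ℝ), Complex.exp (-(p * x)) *
      ((x ^ (2 * b - 1) * hyp12 1 1 b (-(t * (x ^ 2 / 4))) : ℝ) : ℂ) =
      Real.Gamma (2 * b) * (p * (p ^ 2 + t) ^ ((-(b + 1 / 2) : ℝ) : ℂ)) := by
  have hopen : IsOpen {p : ℂ | 0 < p.re} := isOpen_lt continuous_const Complex.continuous_re
  have hcont : Continuous (hyp12 1 1 b) := continuous_hyp12 one_pos hb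
  have hL := differentiableOn_laplace
    (g := fun x => x ^ (2 * b - 1) * hyp12 1 1 b (-(t * (x ^ 2 / 4)))) (fun ε hε => by
      refine (integrableOn_exp_mul_rpow_mul_quadratic (1 / (4 * (b * (b + 1)))) hb hε).mono'
        (by fun_prop) ?_
      filter_upwards [ae_restrict_mem measurableSet_Ioi] with x hx
      have hx' : (0 : ℝ) < x := hx
      rw [norm_mul, norm_mul, Real.norm_of_nonneg (Real.exp_pos _).le,
        Real.norm_of_nonneg (Real.rpow_nonneg hx'.le _), Real.norm_eq_abs]
      have := abs_hyp12_one_le_quadratic (x := x) hb ht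
      gcongr)
  have hR : DifferentiableOn ℂ (fun p : ℂ => (Real.Gamma (2 * b) : ℂ) *
      (p * (p ^ 2 + t) ^ ((-(b + 1 / 2) : ℝ) : ℂ))) {p : ℂ | 0 < p.re} := by
    intro q hq
    have h1 : DifferentiableAt ℂ (fun p : ℂ => p ^ 2 + (t : ℂ)) q := by fun_prop
    exact ((differentiableAt_id.mul (h1.cpow (differentiableAt_const _)
      (sq_add_mem_slitPlane hq ht.1))).const_mul _).differentiableWithinAt
  have hpre : IsPreconnected {p : ℂ | 0 < p.re} := (convex_halfSpace_re_gt 0).isPreconnected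
  -- Both sides are holomorphic on the half-plane and agree at real p near 2, so the identity
  -- theorem applies.
  have hmap : Tendsto (fun x : ℝ => (x : ℂ)) (𝓝[≠] 2) (𝓝[≠] (2 : ℂ)) := by
    refine tendsto_nhdsWithin_iff.2 ⟨?_, ?_⟩
    · exact (Complex.continuous_ofReal.tendsto 2).mono_left nhdsWithin_le_nhds
    · filter_upwards [self_mem_nhdsWithin] with x hx
      intro h
      exact hx (Complex.ofReal_injective (by simpa using h))
  have hfreq : ∃ᶠ p : ℂ in 𝓝[≠] 2, ∫ x in Ioi (0 : ℝ), Complex.exp (-(p * x)) *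
      ((x ^ (2 * b - 1) * hyp12 1 1 b (-(t * (x ^ 2 / 4))) : ℝ) : ℂ) =
      Real.Gamma (2 * b) * (p * (p ^ 2 + t) ^ ((-(b + 1 / 2) : ℝ) : ℂ)) := by
    refine hmap.frequently (Eventually.frequently ?_)
    have h1 : ∀ᶠ x : ℝ in 𝓝[≠] 2, 1 < x := nhdsWithin_le_nhds (lt_mem_nhds one_lt_two)
    filter_upwards [h1] with x hx
    have h := congrArg (fun r : ℝ => (r : ℂ)) (integral_exp_mul_rpow_mul_hyp12 hb hx ht)
    have hnn : 0 ≤ x ^ 2 + t := add_nonneg (sq_nonneg x) ht.1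
    simp only [← integral_complex_ofReal] at h
    rw [Complex.ofReal_mul, Complex.ofReal_mul, Complex.ofReal_cpow hnn, mul_assoc] at h
    push_cast at h ⊢
    exact h
  exact (hL.analyticOnNhd hopen).eqOn_of_preconnected_of_frequently_eq (hR.analyticOnNhd hopen)
    hpre (show (0 : ℝ) < (2 : ℂ).re by norm_num) hfreq hp

/-- Raise the parameter a to c, starting from ₁F₂(a; a, b; ·) = ₀F₁(; b; ·). -/
lemma hyp12_eq_integral_hyp12_one {a b c : ℝ} (ha : 0 < a) (hb : 0 < b) (hac : a < c) (y : ℝ) :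
    hyp12 a b c (-y) = ∫ t, hyp12 1 1 b (-(t * y)) ∂betaMeasure a (c - a) := by
  have h := hyp12_add_eq_integral (a := a) ha hb (sub_pos.2 hac) (-y)
  rw [add_sub_cancel, hyp12_symm] at h
  rw [h]
  simp only [hyp12_self ha, mul_neg]

/-- The Laplace transform of `x ^ (2 b - 1) ₁F₂(a; b, c; -x² / 4)`. -/
lemma laplace_rpow_mul_hyp12 {a b c : ℝ} (ha : 0 < a) (hb : 0 < b) (hac : a < c) {p : ℂ}
    (hp : 0 < p.re) :
    ∫ x in Ioi (0 : ℝ), Complex.exp (-(p * x)) *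
      ((x ^ (2 * b - 1) * hyp12 a b c (-(x ^ 2 / 4)) : ℝ) : ℂ) =
      Real.Gamma (2 * b) * (p * ∫ t : ℝ, (p ^ 2 + t) ^ ((-(b + 1 / 2) : ℝ) : ℂ)
        ∂betaMeasure a (c - a)) := by
  have := isProbabilityMeasureBeta ha (sub_pos.2 hac)
  have hcont : Continuous (hyp12 1 1 b) := continuous_hyp12 one_pos hb
  have hint : Integrable (Function.uncurry fun (x t : ℝ) => Complex.exp (-(p * x)) *
      ((x ^ (2 * b - 1) * hyp12 1 1 b (-(t * (x ^ 2 / 4))) : ℝ) : ℂ))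
      ((volume.restrict (Ioi 0)).prod (betaMeasure a (c - a))) := by
    have hbd := (integrableOn_exp_mul_rpow_mul_quadratic (1 / (4 * (b * (b + 1)))) hb hp).comp_fst
      (betaMeasure a (c - a))
    refine hbd.mono' (Measurable.aestronglyMeasurable (by
      simp only [Function.uncurry_def]
      fun_prop)) ?_
    have h1 := Measure.quasiMeasurePreserving_fst
      (μ := volume.restrict (Ioi (0 : ℝ))) (ν := betaMeasure a (c - a)) |>.ae
      (ae_restrict_mem measurableSet_Ioi)
    have h2 := Measure.quasiMeasurePreserving_snd
      (μ := volume.restrict (Ioi (0 : ℝ))) (ν := betaMeasure a (c - a)) |>.ae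
      (ae_mem_Ioo_beta a (c - a))
    filter_upwards [h1, h2] with z hz1 hz2
    have hz1' : 0 < z.1 := hz1
    have h3 := abs_hyp12_one_le_quadratic (x := z.1) hb (Ioo_subset_Icc_self hz2)
    simp only [Function.uncurry_def]
    rw [norm_mul, Complex.norm_exp, Complex.norm_real, norm_mul,
      Real.norm_of_nonneg (Real.rpow_nonneg hz1'.le _), Real.norm_eq_abs]
    have h4 : (-(p * (z.1 : ℂ))).re = -(p.re * z.1) := by simp
    rw [h4]
    gcongr
  have hx : ∀ x : ℝ, Complex.exp (-(p * x)) *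
      ((x ^ (2 * b - 1) * hyp12 a b c (-(x ^ 2 / 4)) : ℝ) : ℂ) =
      ∫ t, Complex.exp (-(p * x)) *
      ((x ^ (2 * b - 1) * hyp12 1 1 b (-(t * (x ^ 2 / 4))) : ℝ) : ℂ) ∂betaMeasure a (c - a) := by
    intro x
    rw [integral_const_mul, integral_complex_ofReal, integral_const_mul,
      hyp12_eq_integral_hyp12_one ha hb hac]
  simp only [hx]
  rw [integral_integral_swap hint, ← integral_const_mul, ← integral_const_mul]
  refine integral_congr_ae ?_
  filter_upwards [ae_mem_Ioo_beta a (c - a)] with t ht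
  exact laplace_rpow_mul_hyp12_one hb (Ioo_subset_Icc_self ht) hp

/-- If `₁F₂(a; b, c; -x² / 4)` is nonnegative, its Laplace transform is dominated by the values on
the positive half-line. -/
lemma norm_integral_cpow_le {a b c : ℝ} (ha : 0 < a) (hb : 0 < b) (hac : a < c)
    (hnn : ∀ x : ℝ, 0 < x → 0 ≤ hyp12 a b c (-(x ^ 2 / 4))) {p : ℂ} (hp : 0 < p.re) :
    ‖p‖ * ‖∫ t : ℝ, (p ^ 2 + t) ^ ((-(b + 1 / 2) : ℝ) : ℂ) ∂betaMeasure a (c - a)‖ ≤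
      p.re * ∫ t : ℝ, (p.re ^ 2 + t) ^ (-(b + 1 / 2)) ∂betaMeasure a (c - a) := by
  have hG : 0 < Real.Gamma (2 * b) := Real.Gamma_pos_of_pos (by positivity)
  have h1 : ∫ x in Ioi (0 : ℝ), Real.exp (-(p.re * x)) *
      (x ^ (2 * b - 1) * hyp12 a b c (-(x ^ 2 / 4))) =
      Real.Gamma (2 * b) * (p.re * ∫ t : ℝ, (p.re ^ 2 + t) ^ (-(b + 1 / 2))
        ∂betaMeasure a (c - a)) := by
    have h := laplace_rpow_mul_hyp12 ha hb hac (p := (p.re : ℂ)) (by simpa using hp)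
    have h2 : ∫ t : ℝ, ((p.re : ℂ) ^ 2 + t) ^ ((-(b + 1 / 2) : ℝ) : ℂ) ∂betaMeasure a (c - a) =
        ((∫ t : ℝ, (p.re ^ 2 + t) ^ (-(b + 1 / 2)) ∂betaMeasure a (c - a) : ℝ) : ℂ) := by
      rw [← integral_complex_ofReal]
      refine integral_congr_ae ?_
      filter_upwards [ae_mem_Ioo_beta a (c - a)] with t ht
      rw [Complex.ofReal_cpow (add_nonneg (sq_nonneg _) ht.1.le)]
      push_cast
      rfl
    have h3 : ∀ x : ℝ, Complex.exp (-((p.re : ℂ) * x)) *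
        ((x ^ (2 * b - 1) * hyp12 a b c (-(x ^ 2 / 4)) : ℝ) : ℂ) =
        ((Real.exp (-(p.re * x)) * (x ^ (2 * b - 1) * hyp12 a b c (-(x ^ 2 / 4))) : ℝ) : ℂ) := by
      intro x
      push_cast
      rfl
    simp only [h3, integral_complex_ofReal, h2] at h
    exact_mod_cast h
  have h2 := norm_integral_le_integral_norm (μ := volume.restrict (Ioi (0 : ℝ))) (fun x : ℝ =>
    Complex.exp (-(p * x)) * ((x ^ (2 * b - 1) * hyp12 a b c (-(x ^ 2 / 4)) : ℝ) : ℂ))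
  have h3 : ∫ x in Ioi (0 : ℝ), ‖Complex.exp (-(p * x)) *
      ((x ^ (2 * b - 1) * hyp12 a b c (-(x ^ 2 / 4)) : ℝ) : ℂ)‖ =
      ∫ x in Ioi (0 : ℝ), Real.exp (-(p.re * x)) *
        (x ^ (2 * b - 1) * hyp12 a b c (-(x ^ 2 / 4))) := by
    refine setIntegral_congr_fun measurableSet_Ioi fun x hx => ?_
    have hx' : (0 : ℝ) < x := hx
    have h4 : (-(p * (x : ℂ))).re = -(p.re * x) := by simp
    simp only [norm_mul, Complex.norm_exp, Complex.norm_real, h4,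
      Real.norm_of_nonneg (hnn x hx), Real.norm_of_nonneg (Real.rpow_nonneg hx'.le _)]
  rw [h3, h1, laplace_rpow_mul_hyp12 ha hb hac hp, norm_mul, norm_mul, Complex.norm_real,
    Real.norm_of_nonneg hG.le] at h2
  exact le_of_mul_le_mul_left h2 hG

/-! ### Estimates for the Laplace transform near the real and the imaginary axis -/

/-- Split the exponent m as (m - θ) + θ, bounding ε² + t below by ε² in one factor and by t in the
other. The moment of order -θ is finite because θ < a. -/
lemma integral_rpow_sq_add_le {a q m θ ε : ℝ} (ha : 0 < a) (hq : 0 < q) (hθ : 0 ≤ θ) (hθa : θ < a)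
    (hθm : θ ≤ m) (hε : 0 < ε) :
    ∫ t : ℝ, (ε ^ 2 + t) ^ (-m) ∂betaMeasure a q ≤
      ε ^ (-(2 * (m - θ))) * (beta (a - θ) q / beta a q) := by
  have h := integral_rpow_beta (r := -θ) ha hq (by linarith)
  rw [sub_eq_add_neg a θ, ← h, ← integral_const_mul]
  refine integral_mono_of_nonneg ?_
    ((integrable_rpow_beta (r := -θ) ha hq (by linarith)).const_mul _) ?_
  · filter_upwards [ae_mem_Ioo_beta a q] with t ht
    have := ht.1
    positivity
  · filter_upwards [ae_mem_Ioo_beta a q] with t ht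
    have ht0 := ht.1
    have h1 : ε ^ (-(2 * (m - θ))) = (ε ^ 2) ^ (-(m - θ)) := by
      rw [← Real.rpow_natCast ε 2, ← Real.rpow_mul hε.le]
      congr 1
      push_cast
      ring
    rw [h1, show -m = -(m - θ) + -θ by ring, Real.rpow_add (by positivity)]
    refine mul_le_mul ?_ ?_ (by positivity) (by positivity)
    · exact Real.rpow_le_rpow_of_nonpos (by positivity) (by linarith) (by linarith)
    · exact Real.rpow_le_rpow_of_nonpos (by positivity) (by nlinarith) (by linarith)

lemma le_measureReal_beta_Ioo {a q ε : ℝ} (ha : 0 < a) (hq : 0 < q) (hε : 0 < ε)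
    (hε2 : ε ≤ 1 / 2) :
    1 / beta a q * (1 / 2) ^ a / q * ε ^ q ≤ (betaMeasure a q).real (Ioo (1 - ε) 1) := by
  have hB := beta_pos ha hq
  have := isProbabilityMeasureBeta ha hq
  have h1 : (betaMeasure a q).real (Ioo (1 - ε) 1) = ∫ t in Ioo (1 - ε) 1, betaPDFReal a q t := by
    rw [← integral_indicator_one measurableSet_Ioo, integral_beta ha hq,
      ← integral_indicator measurableSet_Ioo]
    congr 1
    ext t
    by_cases ht : t ∈ Ioo (1 - ε) 1 <;> simp [ht]
  have hint : IntegrableOn (fun t : ℝ => (1 - t) ^ (q - 1)) (Ioo (1 - ε) 1) := by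
    have := (intervalIntegral.intervalIntegrable_rpow' (a := 0) (b := ε)
      (show -1 < q - 1 by linarith)).comp_sub_left 1
    rw [sub_zero] at this
    exact ((intervalIntegrable_iff_integrableOn_Ioc_of_le (by linarith)).1 this.symm).mono_set
      Ioo_subset_Ioc_self
  have h2 : ∫ t in Ioo (1 - ε) 1, (1 - t) ^ (q - 1) = ε ^ q / q := by
    rw [← integral_Ioc_eq_integral_Ioo, ← intervalIntegral.integral_of_le (by linarith),
      intervalIntegral.integral_comp_sub_left (fun u : ℝ => u ^ (q - 1)) 1, sub_self,
      sub_sub_cancel, integral_rpow (Or.inl (by linarith))]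
    simp [Real.zero_rpow hq.ne']
  have h3 : 1 / beta a q * (1 / 2) ^ a / q * ε ^ q =
      ∫ t in Ioo (1 - ε) 1, 1 / beta a q * (1 / 2) ^ a * (1 - t) ^ (q - 1) := by
    rw [integral_const_mul, h2]
    ring
  rw [h1, h3]
  refine setIntegral_mono_on (hint.const_mul _) (integrable_betaPDFReal ha hq).integrableOn
    measurableSet_Ioo fun t ht => ?_
  have ht0 : 1 / 2 ≤ t := by linarith [ht.1]
  have ht1 : 0 ≤ 1 - t := by linarith [ht.2]
  rw [betaPDFReal, if_pos ⟨by linarith, ht.2⟩]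
  gcongr
  -- Passing through t^a avoids a case distinction on the sign of a - 1.
  calc (1 / 2 : ℝ) ^ a ≤ t ^ a := by gcongr
    _ ≤ t ^ (a - 1) := Real.rpow_le_rpow_of_exponent_ge (by linarith) ht.2.le (by linarith)

/-- On a narrow sector around the negative real axis, `w ^ (-m)` is, up to a constant phase,
nearly positive. -/
lemma half_norm_rpow_le_re {m : ℝ} (hm : 0 < m) {w : ℂ} (hre : w.re < 0) (him : 0 < w.im)
    (hw : 2 * m * w.im ≤ -w.re) :
    1 / 2 * ‖w‖ ^ (-m) ≤
      (Complex.exp (Real.pi * m * Complex.I) * w ^ ((-m : ℝ) : ℂ)).re := by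
  have hw0 : w ≠ 0 := by
    rintro rfl
    simp at him
  have hn : 0 < ‖w‖ := norm_pos_iff.2 hw0
  -- ψ is the angle to the negative axis; after the rotation the power has argument mψ. From ψ ≤ 2
  -- sin ψ and `hw`, mψ ≤ 1, so its cosine is at least 1/2.
  set ψ := Real.pi - Complex.arg w with hψ
  have hcos : 0 < Real.cos ψ := by
    rw [hψ, Real.cos_pi_sub, Complex.cos_arg hw0]
    have := div_neg_of_neg_of_pos hre hn
    linarith
  have hψ0 : 0 ≤ ψ := sub_nonneg.2 (Complex.arg_le_pi w)
  have harg : 0 ≤ Complex.arg w := Complex.arg_nonneg_iff.2 him.le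
  have hψ2 : ψ ≤ Real.pi / 2 := by
    by_contra h
    push Not at h
    exact absurd hcos (not_lt.2 (Real.cos_nonpos_of_pi_div_two_le_of_le h.le (by linarith)))
  have hsin : Real.sin ψ = w.im / ‖w‖ := by
    rw [hψ, Real.sin_pi_sub, Complex.sin_arg]
  have hmψ : m * ψ ≤ 1 := by
    have h1 := Real.mul_le_sin hψ0 hψ2
    have h2 : ψ ≤ 2 * Real.sin ψ := by
      have h3 : ψ ≤ Real.pi / 2 * Real.sin ψ := by
        have := mul_le_mul_of_nonneg_left h1 (show 0 ≤ Real.pi / 2 by positivity)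
        calc ψ = Real.pi / 2 * (2 / Real.pi * ψ) := by field_simp
          _ ≤ _ := this
      have hs : 0 ≤ Real.sin ψ := by rw [hsin]; positivity
      nlinarith [Real.pi_le_four]
    have h3 : m * ψ ≤ 2 * m * w.im / ‖w‖ := by
      calc m * ψ ≤ m * (2 * Real.sin ψ) := by gcongr
        _ = _ := by rw [hsin]; ring
    refine h3.trans ((div_le_one hn).2 (hw.trans ?_))
    exact (neg_le_abs _).trans (Complex.abs_re_le_norm w)
  have hcos2 : 1 / 2 ≤ Real.cos (m * ψ) := by
    have h1 := Real.one_sub_sq_div_two_le_cos (x := m * ψ)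
    have h2 : 0 ≤ m * ψ := by positivity
    nlinarith
  have key : Complex.exp (Real.pi * m * Complex.I) * w ^ ((-m : ℝ) : ℂ) =
      Complex.exp (((-m * Real.log ‖w‖ : ℝ) : ℂ) + ((m * ψ : ℝ) : ℂ) * Complex.I) := by
    rw [Complex.cpow_def_of_ne_zero hw0, ← Complex.exp_add, Complex.log, hψ]
    congr 1
    push_cast
    ring
  rw [key, Complex.exp_add, Complex.exp_mul_I, ← Complex.ofReal_exp, Complex.re_ofReal_mul,
    ← Complex.ofReal_cos, ← Complex.ofReal_sin, Complex.add_re, Complex.ofReal_re,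
    Complex.re_ofReal_mul, Complex.I_re, mul_zero, add_zero, mul_comm (-m), ← Real.rpow_def_of_pos hn,
    mul_comm]
  gcongr

lemma integrable_cpow_beta {a q : ℝ} (ha : 0 < a) (hq : 0 < q) (s : ℂ) {p : ℂ} (hp : 0 < p.re) :
    Integrable (fun t : ℝ => (p ^ 2 + t) ^ s) (betaMeasure a q) := by
  have := isProbabilityMeasureBeta ha hq
  obtain ⟨C, hC⟩ := (isCompact_Icc (a := (0 : ℝ)) (b := 1)).exists_bound_of_continuousOn
    (f := fun t : ℝ => (p ^ 2 + t) ^ s) (by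
      refine ContinuousOn.cpow (by fun_prop) (by fun_prop) fun t ht => ?_
      exact sq_add_mem_slitPlane hp ht.1)
  refine Integrable.of_bound (Measurable.aestronglyMeasurable (by fun_prop)) C ?_
  filter_upwards [ae_mem_Ioo_beta a q] with t ht
  exact hC t ⟨ht.1.le, ht.2.le⟩

lemma le_norm_integral_cpow {a q m ε : ℝ} (ha : 0 < a) (hq : 0 < q) (hm : 0 < m) (hε : 0 < ε)
    (hε2 : ε ≤ 1 / 2) (hεm : 8 * m * ε ≤ 1) :
    ∃ p : ℂ, p.re = ε ∧ 1 ≤ ‖p‖ ∧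
      1 / 2 * ((8 * m + 5) * ε) ^ (-m) * (1 / beta a q * (1 / 2) ^ a / q * ε ^ q) ≤
        ‖∫ t : ℝ, (p ^ 2 + t) ^ ((-m : ℝ) : ℂ) ∂betaMeasure a q‖ := by
  have := isProbabilityMeasureBeta ha hq
  -- This y makes Re(p² + t) = -(1 - t) - 8mε, while Im(p² + t) = 2εy ≤ 4ε. So p² + t lies in the
  -- narrow sector for every t in (0, 1) and no cancellation occurs; for t > 1 - ε its modulus is at
  -- most (8m + 5)ε.
  set y := √(1 + 8 * m * ε + ε ^ 2) with hy
  have hy2 : y ^ 2 = 1 + 8 * m * ε + ε ^ 2 := Real.sq_sqrt (by positivity)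
  have hy0 : 0 ≤ y := Real.sqrt_nonneg _
  have hmε : 0 < m * ε := by positivity
  have hy1 : 1 ≤ y := by
    rw [hy]
    exact Real.one_le_sqrt.2 (by nlinarith)
  have hyle : y ≤ 2 := by
    have : y ^ 2 ≤ 2 ^ 2 := by rw [hy2]; nlinarith
    exact (sq_le_sq₀ hy0 (by norm_num)).1 this
  set p : ℂ := ⟨ε, y⟩ with hp
  have hre : ∀ t : ℝ, (p ^ 2 + t).re = -((1 - t) + 8 * m * ε) := by
    intro t
    simp only [sq, Complex.add_re, Complex.mul_re, Complex.ofReal_re, hp]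
    nlinarith
  have him : ∀ t : ℝ, (p ^ 2 + t).im = 2 * ε * y := by
    intro t
    simp only [sq, Complex.add_im, Complex.mul_im, Complex.ofReal_im, hp]
    ring
  refine ⟨p, rfl, hy1.trans ((le_abs_self _).trans (Complex.abs_im_le_norm p)), ?_⟩
  have hpint := integrable_cpow_beta ha hq ((-m : ℝ) : ℂ) (p := p) hε
  have h1 : (∫ t : ℝ, (Complex.exp (Real.pi * m * Complex.I) * (p ^ 2 + t) ^ ((-m : ℝ) : ℂ)).re
      ∂betaMeasure a q) ≤ ‖∫ t : ℝ, (p ^ 2 + t) ^ ((-m : ℝ) : ℂ) ∂betaMeasure a q‖ := by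
    have e := Complex.reCLM.integral_comp_comm
      (hpint.const_mul (Complex.exp (Real.pi * m * Complex.I)))
    simp only [Complex.reCLM_apply] at e
    rw [e, integral_const_mul]
    refine (Complex.re_le_norm _).trans ?_
    rw [norm_mul, Complex.norm_exp]
    simp
  refine le_trans ?_ h1
  have hfint : Integrable (fun t : ℝ =>
      (Complex.exp (Real.pi * m * Complex.I) * (p ^ 2 + t) ^ ((-m : ℝ) : ℂ)).re)
      (betaMeasure a q) := (hpint.const_mul _).re
  have hlow : ∀ t ∈ Ioo (0 : ℝ) 1, 1 / 2 * ‖p ^ 2 + (t : ℂ)‖ ^ (-m) ≤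
      (Complex.exp (Real.pi * m * Complex.I) * (p ^ 2 + t) ^ ((-m : ℝ) : ℂ)).re := by
    intro t ht
    refine half_norm_rpow_le_re hm ?_ ?_ ?_
    · rw [hre]
      nlinarith [ht.2]
    · rw [him]
      positivity
    · rw [hre, him]
      nlinarith [ht.2, mul_le_mul_of_nonneg_left hyle hmε.le]
  calc 1 / 2 * ((8 * m + 5) * ε) ^ (-m) * (1 / beta a q * (1 / 2) ^ a / q * ε ^ q)
      ≤ 1 / 2 * ((8 * m + 5) * ε) ^ (-m) * (betaMeasure a q).real (Ioo (1 - ε) 1) := by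
        have := le_measureReal_beta_Ioo ha hq hε hε2
        gcongr
    _ = ∫ t in Ioo (1 - ε) 1, 1 / 2 * ((8 * m + 5) * ε) ^ (-m) ∂betaMeasure a q := by
        rw [setIntegral_const, smul_eq_mul, mul_comm]
    _ ≤ ∫ t in Ioo (1 - ε) 1, (Complex.exp (Real.pi * m * Complex.I) *
          (p ^ 2 + t) ^ ((-m : ℝ) : ℂ)).re ∂betaMeasure a q := by
        refine setIntegral_mono_on (integrableOn_const) hfint.integrableOn
          measurableSet_Ioo fun t ht => ?_
        have ht0 : t ∈ Ioo (0 : ℝ) 1 := ⟨by linarith [ht.1], ht.2⟩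
        refine le_trans ?_ (hlow t ht0)
        have hpos : 0 < ‖p ^ 2 + (t : ℂ)‖ := by
          refine lt_of_lt_of_le ?_ (Complex.abs_im_le_norm _)
          rw [him]
          positivity
        have hle : ‖p ^ 2 + (t : ℂ)‖ ≤ (8 * m + 5) * ε := by
          refine (Complex.norm_le_abs_re_add_abs_im _).trans ?_
          rw [hre, him, abs_neg, abs_of_nonneg (by nlinarith [ht.2]), abs_of_nonneg (by positivity)]
          nlinarith [ht.1]
        exact mul_le_mul_of_nonneg_left
          (Real.rpow_le_rpow_of_nonpos hpos hle (by linarith)) (by norm_num)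
    _ ≤ _ := by
        refine setIntegral_le_integral hfint ?_
        filter_upwards [ae_mem_Ioo_beta a q] with t ht
        exact le_trans (by positivity) (hlow t ht)

/-- A necessary condition for the nonnegativity of `₁F₂(a; b, c; -x² / 4)`. -/
lemma le_add_of_nonneg {a b c : ℝ} (ha : 0 < a) (hab : a < b) (hac : a < c)
    (hnn : ∀ x : ℝ, 0 < x → 0 ≤ hyp12 a b c (-(x ^ 2 / 4))) : 3 * a + 1 / 2 ≤ b + c := by
  by_contra! hlt
  have hb : 0 < b := by linarith
  have hq : 0 < c - a := by linarith
  -- The critical value θ = a is excluded, its moment being infinite; the strict inequality leaves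
  -- room for a smaller θ that still gives η > 0.
  obtain ⟨θ, hθ, hθa⟩ := exists_between (show max 0 ((b + c - a - 1 / 2) / 2) < a from
    max_lt ha (by linarith))
  rw [max_lt_iff] at hθ
  set m := b + 1 / 2 with hm
  have hm0 : 0 < m := by positivity
  set c₁ := 1 / 2 * (8 * m + 5) ^ (-m) * (1 / beta a (c - a) * (1 / 2) ^ a / (c - a)) with hc₁
  set c₂ := beta (a - θ) (c - a) / beta a (c - a)
  have hB := beta_pos ha hq
  have hc₁0 : 0 < c₁ := by positivity
  -- η is the exponent 1 - 2(m - θ) of the upper bound minus the exponent c - a - m of the lower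
  -- one.
  set η := 1 - m + 2 * θ - (c - a) with hη
  have hη0 : 0 < η := by linarith [hθ.2]
  have hbound : ∀ ε : ℝ, 0 < ε → ε ≤ 1 / 2 → 8 * m * ε ≤ 1 → c₁ ≤ ε ^ η * c₂ := by
    intro ε hε hε2 hεm
    obtain ⟨p, hpre, hpn, hlow⟩ := le_norm_integral_cpow ha hq hm0 hε hε2 hεm
    have h1 := norm_integral_cpow_le ha hb hac hnn (p := p) (by rw [hpre]; exact hε)
    rw [hpre] at h1
    have h2 := integral_rpow_sq_add_le ha hq hθ.1.le hθa (show θ ≤ m by linarith) hε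
    have h3 := (hlow.trans (le_mul_of_one_le_left (norm_nonneg _) hpn)).trans
      (h1.trans (mul_le_mul_of_nonneg_left h2 hε.le))
    have h4 : 1 / 2 * ((8 * m + 5) * ε) ^ (-m) *
        (1 / beta a (c - a) * (1 / 2) ^ a / (c - a) * ε ^ (c - a)) = ε ^ (c - a - m) * c₁ := by
      rw [Real.mul_rpow (by positivity) hε.le, sub_eq_add_neg (c - a) m, Real.rpow_add hε, hc₁]
      ring
    have h5 : ε * (ε ^ (-(2 * (m - θ))) * c₂) = ε ^ (c - a - m) * (ε ^ η * c₂) := by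
      rw [← mul_assoc, ← mul_assoc, ← Real.rpow_add hε]
      congr 1
      rw [← Real.rpow_one_add' hε.le (by nlinarith)]
      congr 1
      rw [hη]
      ring
    rw [h4, h5] at h3
    exact le_of_mul_le_mul_left h3 (by positivity)
  have hlim : Tendsto (fun ε : ℝ => ε ^ η * c₂) (𝓝[>] 0) (𝓝 0) := by
    have h : Tendsto (fun ε : ℝ => ε ^ η * c₂) (𝓝 0) (𝓝 ((0 : ℝ) ^ η * c₂)) :=
      ((Real.continuousAt_rpow_const 0 η (Or.inr hη0.le)).tendsto).mul_const _
    rw [Real.zero_rpow hη0.ne', zero_mul] at h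
    exact h.mono_left nhdsWithin_le_nhds
  have e1 := hlim.eventually (gt_mem_nhds hc₁0)
  have e2 : ∀ᶠ ε : ℝ in 𝓝[>] 0, ε < 1 / 2 :=
    nhdsWithin_le_nhds (gt_mem_nhds (by norm_num))
  have e3 : ∀ᶠ ε : ℝ in 𝓝[>] 0, ε < 1 / (8 * m) :=
    nhdsWithin_le_nhds (gt_mem_nhds (by positivity))
  obtain ⟨ε, ⟨⟨h1, h2⟩, h3⟩, h4⟩ := (((e1.and e2).and e3).and self_mem_nhdsWithin).exists
  refine absurd (hbound ε h4 h2.le ?_) (not_le.2 h1)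
  rw [lt_div_iff₀ (by positivity)] at h3
  linarith

end Hyp12

theorem theorem3p2 (a b c : ℝ) (ha : 0 < a) (hb : 0 < b) (hc : 0 < c) (Φ : ℝ → ℝ)
    (hΦ : Φ = fun x : ℝ => hyp12 a b c (-(x ^ 2 / 4))) :
    ((a, b, c) ∈ positivitySet → a < b ∧ a < c ∧ 3 * a + 1 / 2 ≤ b + c) ∧
    (b ≤ a → AlternatesInSign Φ ∧ ∃ x ∈ Set.Ioc (0 : ℝ) (besselZero (c - 1)), Φ x = 0) ∧
    (c ≤ a → AlternatesInSign Φ ∧ ∃ x ∈ Set.Ioc (0 : ℝ) (besselZero (b - 1)), Φ x = 0) ∧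
    (((b ≤ a + 1 / 2 ∧ c ≤ 2 * a) ∨ (b ≤ 2 * a ∧ c ≤ a + 1 / 2)) → b + c < 3 * a + 1 / 2 →
      AlternatesInSign Φ ∧
        ∃ x ∈ Set.Ioo (0 : ℝ) (2 * besselZero (a - 1 / 2)), Φ x = 0) := by
  subst hΦ
  have hnot : ∀ {a b c : ℝ}, 0 < a → 0 < b → 0 < c →
      (∀ x : ℝ, 0 < x → 0 < hyp12 a b c (-(x ^ 2 / 4))) → a < b := by
    intro a b c ha hb hc hpos
    by_contra! hle
    obtain ⟨x, hx, hneg⟩ := (Hyp12.alternates_of_le hb hc hle).1.1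
    exact lt_asymm hneg (hpos x hx)
  refine ⟨?_, Hyp12.alternates_of_le hb hc, ?_, ?_⟩
  · rintro ⟨-, -, -, hpos⟩
    have hab := hnot ha hb hc hpos
    have hac := hnot ha hc hb fun x hx => by
      rw [Hyp12.hyp12_symm]
      exact hpos x hx
    exact ⟨hab, hac, Hyp12.le_add_of_nonneg ha hab hac fun x hx => (hpos x hx).le⟩
  · intro hca
    simp only [Hyp12.hyp12_symm a b c]
    exact Hyp12.alternates_of_le hc hb hca
  · rintro (⟨h1, h2⟩ | ⟨h1, h2⟩) hbc
    · exact Hyp12.alternates_of_le_two_mul ha hb hc h1 h2 hbc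
    · simp only [Hyp12.hyp12_symm a b c]
      exact Hyp12.alternates_of_le_two_mul ha hc hb h2 h1 (by linarith)
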